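/- **Setting.** Let $\Omega=(0,L_x)\times(0,L_y)$, $T>0$, $N\ge 1$, $\Delta t=T/N$, $t^n=n\Delta t$. Let $0=x_0<\dots<x_{N_x}=L_x$ and $0=y_0<\dots<y_{N_y}=L_y$ be partitions, with $x_{i+1/2}=\frac{x_i+x_{i+1}}2$, $h_{i+1/2}=x_{i+1}-x_i$, $h_i=\frac{h_{i+1/2}+h_{i-1/2}}2$ ($0<i<N_x$), $h_0=\frac{h_{1/2}}2$, $h_{N_x}=\frac{h_{N_x-1/2}}2$, and $y_{j+1/2},k_{j+1/2},k_j$ defined in the same way in the $y$-direction. The mesh is regular: $\min_{i,j}\{h_{i+1/2},k_{j+1/2}\}\ge C_0\max_{i,j}\{h_{i+1/2},k_{j+1/2}\}$ for a fixed $C_0>0$. For discrete functions put $[d_x\phi]_{i+1/2,m}=\frac{\phi_{i+1,m}-\phi_{i,m}}{h_{i+1/2}}$, $[D_x\phi]_{i,m}=\frac{\phi_{i+1/2,m}-\phi_{i-1/2,m}}{h_i}$, similarly $d_y,D_y$ with $k_{j+1/2},k_j$, and $[d_t\phi]^n=\frac{\phi^n-\phi^{n-1}}{\Delta t}$; positions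 outside of $\overline\Omega$ are replaced by the neighbouring boundary position (so $\phi_{l,-1/2}:=\phi_{l,0}$, and so on). Put $$(f,g)_{l^2,M}=\sum_{i=0}^{N_x-1}\sum_{j=0}^{N_y-1}h_{i+1/2}k_{j+1/2}(fg)_{i+1/2,j+1/2},\qquad \|f\|_{l^2,M}^2=(f,f)_{l^2,M},$$ $$\|\mathbf u\|_{l^2}^2=\sum_{i=1}^{N_x-1}\sum_{j=0}^{N_y-1}h_ik_{j+1/2}(u^x_{i,j+1/2})^2+\sum_{i=0}^{N_x-1}\sum_{j=1}^{N_y-1}h_{i+1/2}k_j(u^y_{i+1/2,j})^2 .$$ For a vector field $\mathbf q=(q^x,q^y)$ let its averages be $$\hat q^{x,n}_{i,j+1/2}=\frac1{h_i}\int_{x_{i-1/2}}^{x_{i+1/2}}q^x(x,y_{j+1/2},t^n)\,dx,\qquad \hat q^{y,n}_{i+1/2,j}=\frac1{k_j}\int_{y_{j-1/2}}^{y_{j+1/2}}q^y(x_{i+1/2},y,t^n)\,dy .$$ **RMAC scheme.** Let $\mu>0$, let $\mathbf g=(g^x,g^y)$ be a source term that is integrable over the segments above at the times $t^1,\dots,t^N$,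 and let $\mathbf f^n=\hat{\mathbf g}^n$. Suppose that $W^{x,n}_{i,j+1/2}$, $W^{y,n}_{i+1/2,j}$ $(0\le n\le N)$ and $Z^n_{i+1/2,j+1/2}$ $(1\le n\le N)$ satisfy the boundary conditions $W^{x,n}=0$ at the positions $(0,j+\frac12),(N_x,j+\frac12),(i,0),(i,N_y)$ and $W^{y,n}=0$ at $(0,j),(N_x,j),(i+\frac12,0),(i+\frac12,N_y)$, the initial condition $\mathbf W^0=0$, the normalization $(Z^n,1)_{l^2,M}=0$, and for $1\le n\le N$ $$d_tW^{x,n}_{i,j+1/2}-\mu\frac{d_xW^{x,n}_{i+1/2,j+1/2}-d_xW^{x,n}_{i-1/2,j+1/2}}{h_i}-\mu\frac{D_yW^{x,n}_{i,j+1}-D_yW^{x,n}_{i,j}}{k_{j+1/2}}+D_xZ^n_{i,j+1/2}=f^{x,n}_{i,j+1/2}\quad(1\le i\le N_x-1,\ 0\le j\le N_y-1),$$ $$d_tW^{y,n}_{i+1/2,j}-\mu\frac{D_xW^{y,n}_{i+1,j}-D_xW^{y,n}_{i,j}}{h_{i+1/2}}-\mu\frac{d_yW^{y,n}_{i+1/2,j+1/2}-d_yW^{y,n}_{i+1/2,j-1/2}}{k_j}+D_yZ^n_{i+1/2,j}=f^{y,n}_{i+1/2,j}\quad(0\le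 i\le N_x-1,\ 1\le j\le N_y-1),$$ $$d_xW^{x,n}_{i+1/2,j+1/2}+d_yW^{y,n}_{i+1/2,j+1/2}=0\quad(0\le i\le N_x-1,\ 0\le j\le N_y-1).$$ **Theorem (Stability).** There are constants $C>0$ and $\delta>0$ that depend only on $L_x,L_y,T,C_0$ (and not on the viscosity $\mu$, the mesh, $\Delta t$, $\mathbf g$ or the solution) such that, whenever $\Delta t\le\delta$, the following holds for every $1\le m\le N$. 1. For every $p$ such that $p(\cdot,\cdot,t)\in C^1(\Omega)$ for $t\in(0,T]$ (in particular for the exact pressure of the Stokes problem $\partial_t\mathbf u-\mu\Delta\mathbf u+\nabla p=\mathbf g$, $\nabla\cdot\mathbf u=0$, when it has this regularity), with $\beta=\mathbf g-\nabla p$, $$\|\mathbf W^m\|_{l^2}^2\le C\sum_{n=1}^m\Delta t\,\|\hat\beta^n\|_{l^2}^2 .$$ 2. $$\|Z^m\|_{l^2,M}^2\le C\Big(\sum_{n=2}^m\Delta t\,\|d_t\mathbf f^n\|_{l^2}^2+\mu\sum_{n=1}^m\Delta t\,\|\mathbf f^n\|_{l^2}^2+\|\mathbf f^1\|_{l^2}^2+\|\mathbf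 f^m\|_{l^2}^2\Big).$$ -/

import Mathlib

namespace RMAC

/-- A partition `0 = x_0 < x_1 < ⋯ < x_{num} = L` of the interval `[0, L]`; the values `node i`
with `i > num` play no role. -/
structure Grid1D (L : ℝ) where
  num : ℕ
  num_pos : 0 < num
  node : ℕ → ℝ
  node_zero : node 0 = 0
  node_last : node num = L
  node_lt : ∀ i < num, node i < node (i + 1)

namespace Grid1D

variable {L : ℝ} (G : Grid1D L)

/-- The points of the partition and the midpoints of its cells, with doubled indices:
`pt (2 * i) = x_i` and `pt (2 * i + 1) = x_{i + 1/2} = (x_i + x_{i+1}) / 2`. -/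
noncomputable def pt (a : ℕ) : ℝ := (G.node (a / 2) + G.node ((a + 1) / 2)) / 2

/-- The cell length `h_{i + 1/2} = x_{i+1} - x_i`, for `0 ≤ i ≤ num - 1`. -/
def cell (i : ℕ) : ℝ := G.node (i + 1) - G.node i

/-- The dual length `h_i = (h_{i + 1/2} + h_{i - 1/2}) / 2`, for `0 ≤ i ≤ num`, where cells outside
of the interval have length zero; so `h_0 = h_{1/2} / 2` and `h_{num} = h_{num - 1/2} / 2`. -/
noncomputable def dual (i : ℕ) : ℝ :=
  ((if i < G.num then G.cell i else 0) + (if 0 < i then G.cell (i - 1) else 0)) / 2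

end Grid1D

/-- Discrete functions on the staggered grid, with doubled indices: `φ a b` is the value
`φ_{a/2, b/2}` at the point `(x_{a/2}, y_{b/2})`. For example `φ_{i, j + 1/2}` is
`φ (2 * i) (2 * j + 1)`. -/
abbrev GridFun : Type := ℕ → ℕ → ℝ

section Operators

variable {Lx Ly : ℝ} (Gx : Grid1D Lx) (Gy : Grid1D Ly)

/-- `[d_x φ]_{i + 1/2, b/2}`, for `0 ≤ i ≤ N_x - 1`. -/
noncomputable def dx (φ : GridFun) (i b : ℕ) : ℝ :=
  (φ (2 * i + 2) b - φ (2 * i) b) / Gx.cell i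

/-- `[d_y φ]_{a/2, j + 1/2}`, for `0 ≤ j ≤ N_y - 1`. -/
noncomputable def dy (φ : GridFun) (a j : ℕ) : ℝ :=
  (φ a (2 * j + 2) - φ a (2 * j)) / Gy.cell j

/-- `[D_x φ]_{i, b/2} = (φ_{i + 1/2, b/2} - φ_{i - 1/2, b/2}) / h_i`, for `0 ≤ i ≤ N_x`. Positions
outside of the domain are replaced by the neighbouring boundary position: the (doubled) index
`2 * N_x + 1` becomes `2 * N_x`, and for `i = 0` the truncated subtraction `2 * i - 1` is `0`. -/
noncomputable def Dx (φ : GridFun) (i b : ℕ) : ℝ :=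
  (φ (min (2 * i + 1) (2 * Gx.num)) b - φ (2 * i - 1) b) / Gx.dual i

/-- `[D_y φ]_{a/2, j} = (φ_{a/2, j + 1/2} - φ_{a/2, j - 1/2}) / k_j`, for `0 ≤ j ≤ N_y`, with the
same convention at the boundary as for `Dx`. -/
noncomputable def Dy (φ : GridFun) (a j : ℕ) : ℝ :=
  (φ a (min (2 * j + 1) (2 * Gy.num)) - φ a (2 * j - 1)) / Gy.dual j

/-- The backward difference quotient in time `[d_t φ]^n = (φ^n - φ^{n-1}) / Δt`, for `n ≥ 1`. -/
noncomputable def dt (Δt : ℝ) (φ : ℕ → GridFun) (n : ℕ) : GridFun :=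
  fun a b => (φ n a b - φ (n - 1) a b) / Δt

/-- `(f, g)_{l², M}`, the inner product over cell centres `(x_{i+1/2}, y_{j+1/2})`. -/
noncomputable def innerM (f g : GridFun) : ℝ :=
  ∑ i ∈ Finset.range Gx.num, ∑ j ∈ Finset.range Gy.num,
    Gx.cell i * Gy.cell j * f (2 * i + 1) (2 * j + 1) * g (2 * i + 1) (2 * j + 1)

/-- `(f, g)_{l², T, M}`, the inner product over the interior points `(x_i, y_{j+1/2})`. -/
noncomputable def innerTM (f g : GridFun) : ℝ :=
  ∑ i ∈ Finset.Ico 1 Gx.num, ∑ j ∈ Finset.range Gy.num,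
    Gx.dual i * Gy.cell j * f (2 * i) (2 * j + 1) * g (2 * i) (2 * j + 1)

/-- `(f, g)_{l², M, T}`, the inner product over the interior points `(x_{i+1/2}, y_j)`. -/
noncomputable def innerMT (f g : GridFun) : ℝ :=
  ∑ i ∈ Finset.range Gx.num, ∑ j ∈ Finset.Ico 1 Gy.num,
    Gx.cell i * Gy.dual j * f (2 * i + 1) (2 * j) * g (2 * i + 1) (2 * j)

/-- `‖f‖_{l², M}`. -/
noncomputable def normM (f : GridFun) : ℝ := √(innerM Gx Gy f f)

/-- `‖f‖_{l², T, M}`. -/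
noncomputable def normTM (f : GridFun) : ℝ := √(innerTM Gx Gy f f)

/-- `‖f‖_{l², M, T}`. -/
noncomputable def normMT (f : GridFun) : ℝ := √(innerMT Gx Gy f f)

/-- The discrete norm `‖u‖_{l²}` of a vector-valued discrete function `u = (ux, uy)`, with
`‖u‖² = ‖ux‖²_{l², T, M} + ‖uy‖²_{l², M, T}`. -/
noncomputable def vecNorm (ux uy : GridFun) : ℝ :=
  √(normTM Gx Gy ux ^ 2 + normMT Gx Gy uy ^ 2)

/-- The regularity condition `min {h_{i+1/2}, k_{j+1/2}} ≥ C₀ * max {h_{i+1/2}, k_{j+1/2}}` on the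
mesh. -/
def IsRegular (C₀ : ℝ) : Prop :=
  ∀ a ∈ Gx.cell '' Set.Iio Gx.num ∪ Gy.cell '' Set.Iio Gy.num,
    ∀ b ∈ Gx.cell '' Set.Iio Gx.num ∪ Gy.cell '' Set.Iio Gy.num, C₀ * b ≤ a

/-- The finite volume averages in the `x` direction: at `a = 2 * i`, `b = 2 * j + 1` this is
`(1 / h_i) ∫_{x_{i-1/2}}^{x_{i+1/2}} q(x, y_{j+1/2}, t) dx`. It is used for `1 ≤ i ≤ N_x - 1`. -/
noncomputable def avgX (q : ℝ → ℝ → ℝ → ℝ) (t : ℝ) : GridFun :=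
  fun a b => 1 / Gx.dual (a / 2) * ∫ x in (Gx.pt (a - 1))..(Gx.pt (a + 1)), q x (Gy.pt b) t

/-- The finite volume averages in the `y` direction: at `a = 2 * i + 1`, `b = 2 * j` this is
`(1 / k_j) ∫_{y_{j-1/2}}^{y_{j+1/2}} q(x_{i+1/2}, y, t) dy`. It is used for `1 ≤ j ≤ N_y - 1`. -/
noncomputable def avgY (q : ℝ → ℝ → ℝ → ℝ) (t : ℝ) : GridFun :=
  fun a b => 1 / Gy.dual (b / 2) * ∫ y in (Gy.pt (b - 1))..(Gy.pt (b + 1)), q (Gx.pt a) y t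

/-- The force `g = (gx, gy)` is integrable, at the time `t`, over the segments that occur in the
finite volume averages of `gx` and `gy`. -/
def SegmentIntegrable (gx gy : ℝ → ℝ → ℝ → ℝ) (t : ℝ) : Prop :=
  (∀ i ∈ Finset.Ico 1 Gx.num, ∀ j ∈ Finset.range Gy.num,
    IntervalIntegrable (fun x => gx x (Gy.pt (2 * j + 1)) t) MeasureTheory.volume
      (Gx.pt (2 * i - 1)) (Gx.pt (2 * i + 1))) ∧
  (∀ i ∈ Finset.range Gx.num, ∀ j ∈ Finset.Ico 1 Gy.num,
    IntervalIntegrable (fun y => gy (Gx.pt (2 * i + 1)) y t) MeasureTheory.volume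
      (Gy.pt (2 * j - 1)) (Gy.pt (2 * j + 1)))

/-- `(Wx, Wy, Z)` solves the reconstructed MAC scheme with viscosity `μ`, time step `Δt`, time
levels `n = 0, …, N` and source term `g = (gx, gy)`. The superscript `n` is the first argument of
`Wx`, `Wy` and `Z`. -/
structure IsSolution (μ Δt : ℝ) (N : ℕ) (gx gy : ℝ → ℝ → ℝ → ℝ)
    (Wx Wy Z : ℕ → GridFun) : Prop where
  /-- Boundary values of the first velocity component. -/
  bdry_x_left : ∀ n ≤ N, ∀ j < Gy.num, Wx n 0 (2 * j + 1) = 0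
  bdry_x_right : ∀ n ≤ N, ∀ j < Gy.num, Wx n (2 * Gx.num) (2 * j + 1) = 0
  bdry_x_bottom : ∀ n ≤ N, ∀ i ≤ Gx.num, Wx n (2 * i) 0 = 0
  bdry_x_top : ∀ n ≤ N, ∀ i ≤ Gx.num, Wx n (2 * i) (2 * Gy.num) = 0
  /-- Boundary values of the second velocity component. -/
  bdry_y_left : ∀ n ≤ N, ∀ j ≤ Gy.num, Wy n 0 (2 * j) = 0
  bdry_y_right : ∀ n ≤ N, ∀ j ≤ Gy.num, Wy n (2 * Gx.num) (2 * j) = 0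
  bdry_y_bottom : ∀ n ≤ N, ∀ i < Gx.num, Wy n (2 * i + 1) 0 = 0
  bdry_y_top : ∀ n ≤ N, ∀ i < Gx.num, Wy n (2 * i + 1) (2 * Gy.num) = 0
  /-- Initial values. -/
  init_x : ∀ i ∈ Finset.Ico 1 Gx.num, ∀ j ∈ Finset.range Gy.num, Wx 0 (2 * i) (2 * j + 1) = 0
  init_y : ∀ i ∈ Finset.range Gx.num, ∀ j ∈ Finset.Ico 1 Gy.num, Wy 0 (2 * i + 1) (2 * j) = 0
  /-- The discrete momentum equations. -/
  momentum_x : ∀ n ∈ Finset.Icc 1 N, ∀ i ∈ Finset.Ico 1 Gx.num, ∀ j ∈ Finset.range Gy.num,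
    dt Δt Wx n (2 * i) (2 * j + 1)
      - μ * ((dx Gx (Wx n) i (2 * j + 1) - dx Gx (Wx n) (i - 1) (2 * j + 1)) / Gx.dual i)
      - μ * ((Dy Gy (Wx n) (2 * i) (j + 1) - Dy Gy (Wx n) (2 * i) j) / Gy.cell j)
      + Dx Gx (Z n) i (2 * j + 1)
      = avgX Gx Gy gx (n * Δt) (2 * i) (2 * j + 1)
  momentum_y : ∀ n ∈ Finset.Icc 1 N, ∀ i ∈ Finset.range Gx.num, ∀ j ∈ Finset.Ico 1 Gy.num,
    dt Δt Wy n (2 * i + 1) (2 * j)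
      - μ * ((Dx Gx (Wy n) (i + 1) (2 * j) - Dx Gx (Wy n) i (2 * j)) / Gx.cell i)
      - μ * ((dy Gy (Wy n) (2 * i + 1) j - dy Gy (Wy n) (2 * i + 1) (j - 1)) / Gy.dual j)
      + Dy Gy (Z n) (2 * i + 1) j
      = avgY Gx Gy gy (n * Δt) (2 * i + 1) (2 * j)
  /-- The discrete incompressibility condition. -/
  div_free : ∀ n ∈ Finset.Icc 1 N, ∀ i ∈ Finset.range Gx.num, ∀ j ∈ Finset.range Gy.num,
    dx Gx (Wx n) i (2 * j + 1) + dy Gy (Wy n) (2 * i + 1) j = 0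
  /-- The discrete pressure has discrete mean zero. -/
  mean_zero : ∀ n ∈ Finset.Icc 1 N, innerM Gx Gy (Z n) (fun _ _ => 1) = 0

end Operators

/-- First component of `β = g - ∇p`. -/
noncomputable def betaX (gx p : ℝ → ℝ → ℝ → ℝ) : ℝ → ℝ → ℝ → ℝ :=
  fun x y t => gx x y t - deriv (fun s => p s y t) x

/-- Second component of `β = g - ∇p`. -/
noncomputable def betaY (gy p : ℝ → ℝ → ℝ → ℝ) : ℝ → ℝ → ℝ → ℝ :=
  fun x y t => gy x y t - deriv (fun s => p x s t) y

end RMAC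

/-!
The velocity bounds are energy estimates. Discretely divergence-free velocities that vanish on the
boundary are orthogonal to discrete gradients, so on them the scheme is an implicit Euler method for
the Dirichlet form (`IsSolution.weak`), and the averages of `g` may be replaced by those of
`g - ∇p` (`velForm_avg_beta`). Testing a step with the new value bounds the norm of the solution by
the time integral of the norm of the force, without a Gronwall argument (`sqrt_le_sum_of_euler`).
The same estimate for the difference quotients in time bounds the acceleration
(`sqrt_diff_le_sum_of_euler`), and testing with the acceleration bounds the dissipation
(`dissipation_le_sum_of_euler`).

The pressure bound does not use a discrete inf-sup condition. As the velocity is divergence-free,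
its Laplacian is the curl of the vorticity, and so the momentum equation reads `∇Z = F + curl r`,
where `F` is the force minus the acceleration and `r` is the viscosity times the vorticity; this
identity is exact on the staggered grid. What remains is the bound of `‖Z‖` by `‖F‖` and `‖r‖`,
which is proved in two steps with the distance `d` to the boundary as a weight.

* `weighted_le`, a Caccioppoli inequality: `‖d ∇Z‖` is bounded by `‖F‖` and `‖r‖`. The function
  `d² r` vanishes on the boundary, so its curl is orthogonal to `∇Z`; this controls `d ∇r`.
* `exists_innerM_le_weighted`, a weighted Poincaré inequality: `‖Z‖` is bounded by `‖d ∇Z‖` if `Z`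
  has mean zero. Near the boundary it follows from summation by parts against the vector field
  `-d(z) z`, which is bounded by the weight and has a positive discrete divergence there
  (`div_inwardField_ge`). In the interior the weight is bounded below, and the usual Poincaré
  inequality applies.
-/

namespace RMAC

/-! ### Energy estimates for the implicit Euler method -/

section Energy

variable {V : Type*} [AddCommGroup V] [Module ℝ V] {A B : LinearMap.BilinForm ℝ V}

/-- The step from `a` to `b` of an implicit Euler method with force `f`, tested with `b`. -/
theorem sqrt_le_of_euler_step (hB : ∀ v, 0 ≤ B v v) (hBs : ∀ u v, B u v = B v u)
    {a b f : V} {τ : ℝ} (hτ : 0 ≤ τ) (h : B b b ≤ B a b + τ * B f b) :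
    √(B b b) ≤ √(B a a) + τ * √(B f f) := by
  have cs (u v : V) : B u v ≤ √(B u u) * √(B v v) := by
    rw [← Real.sqrt_mul (hB u)]
    refine Real.le_sqrt_of_sq_le ?_
    have h := B.apply_mul_apply_le_of_forall_zero_le hB u v
    rwa [hBs v u, ← sq] at h
  have h1 : √(B b b) * √(B b b) ≤ (√(B a a) + τ * √(B f f)) * √(B b b) := by
    rw [Real.mul_self_sqrt (hB b)]
    nlinarith [cs a b, mul_le_mul_of_nonneg_left (cs f b) hτ]
  rcases (Real.sqrt_nonneg (B b b)).eq_or_lt with h0 | h0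
  · rw [← h0]; positivity
  · exact le_of_mul_le_mul_right h1 h0

/-- Implicit Euler with zero initial data: the norm of the solution is at most the time integral
of the norm of the force. -/
theorem sqrt_le_sum_of_euler (hA : ∀ v, 0 ≤ A v v) (hB : ∀ v, 0 ≤ B v v)
    (hBs : ∀ u v, B u v = B v u) {w f : ℕ → V} {τ μ : ℝ} {N : ℕ}
    (hτ : 0 < τ) (hμ : 0 < μ) (h0 : B (w 0) (w 0) = 0)
    (hw : ∀ n ∈ Finset.Icc 1 N,
      B (τ⁻¹ • (w n - w (n - 1))) (w n) + μ * A (w n) (w n) = B (f n) (w n)) :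
    ∀ m ≤ N, √(B (w m) (w m)) ≤ ∑ n ∈ Finset.Icc 1 m, τ * √(B (f n) (f n)) := by
  intro m
  induction m with
  | zero => intro _; simp [h0]
  | succ m ih =>
    intro hm
    rw [Finset.sum_Icc_succ_top (by omega)]
    refine (sqrt_le_of_euler_step hB hBs (a := w m) hτ.le (f := f (m + 1)) ?_).trans
      (add_le_add_left (ih (by omega)) _)
    have h := hw (m + 1) (by simp; omega)
    have hp := mul_nonneg hμ.le (hA (w (m + 1)))
    simp only [map_smul, map_sub, LinearMap.smul_apply, LinearMap.sub_apply, smul_eq_mul,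
      add_tsub_cancel_right] at h
    have h2 : B (w (m + 1)) (w (m + 1)) - B (w m) (w (m + 1))
        = τ * (τ⁻¹ * (B (w (m + 1)) (w (m + 1)) - B (w m) (w (m + 1)))) := by
      field_simp
    nlinarith

/-- The difference quotients of the solution solve an implicit Euler method whose force is the
difference quotient of the force; the first step bounds its initial value by `f 1`. -/
theorem sqrt_diff_le_sum_of_euler (hA : ∀ v, 0 ≤ A v v) (hB : ∀ v, 0 ≤ B v v)
    (hBs : ∀ u v, B u v = B v u) {w f : ℕ → V} {τ μ : ℝ} {N : ℕ}
    (hτ : 0 < τ) (hμ : 0 < μ) (h0 : ∀ v, A (w 0) v = 0)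
    (hw : ∀ n ∈ Finset.Icc 1 N, ∀ l ∈ Finset.Icc 1 N,
      B (τ⁻¹ • (w n - w (n - 1))) (w l - w (l - 1)) + μ * A (w n) (w l - w (l - 1))
        = B (f n) (w l - w (l - 1))) :
    ∀ m ∈ Finset.Icc 1 N,
      √(B (τ⁻¹ • (w m - w (m - 1))) (τ⁻¹ • (w m - w (m - 1))))
        ≤ √(B (f 1) (f 1))
          + ∑ n ∈ Finset.Icc 2 m, τ * √(B (τ⁻¹ • (f n - f (n - 1))) (τ⁻¹ • (f n - f (n - 1)))) := by
  have hτi : 0 < τ⁻¹ := inv_pos.mpr hτ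
  intro m hm
  obtain ⟨h1, hmN⟩ := Finset.mem_Icc.mp hm
  clear hm
  induction m, h1 using Nat.le_induction with
  | base =>
    have h := hw 1 (by simp; omega) 1 (by simp; omega)
    rw [show Finset.Icc 2 1 = ∅ from rfl, Finset.sum_empty, add_zero]
    have key := sqrt_le_of_euler_step hB hBs (a := 0) (b := τ⁻¹ • (w 1 - w (1 - 1))) (f := f 1)
      zero_le_one ?_
    · simpa using key
    have hp := mul_nonneg hμ.le (hA (w 1 - w (1 - 1)))
    have h00 := h0 (w 1 - w (1 - 1))
    have e2 : A (w 1 - w (1 - 1)) = A (w 1) - A (w 0) := map_sub _ _ _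
    generalize w 1 - w (1 - 1) = d at *
    simp only [e2, map_smul, LinearMap.smul_apply, LinearMap.sub_apply, smul_eq_mul,
      map_zero, LinearMap.zero_apply, one_mul] at *
    have h3 := congrArg (τ⁻¹ * ·) h
    rw [h00, sub_zero] at hp
    have hp' := mul_nonneg hτi.le hp
    nlinarith
  | succ m hm ih =>
    rw [Finset.sum_Icc_succ_top (by omega), ← add_assoc]
    refine (sqrt_le_of_euler_step hB hBs (a := τ⁻¹ • (w m - w (m - 1))) hτ.le
      (f := τ⁻¹ • (f (m + 1) - f (m + 1 - 1))) ?_).trans (add_le_add_left (ih (by omega)) _)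
    have h := hw (m + 1) (by simp; omega) (m + 1) (by simp; omega)
    have h' := hw m (by simp; omega) (m + 1) (by simp; omega)
    have hp := mul_nonneg (mul_nonneg hτi.le hμ.le) (hA (w (m + 1) - w (m + 1 - 1)))
    simp only [map_smul, LinearMap.smul_apply, smul_eq_mul, add_tsub_cancel_right] at *
    have e1 : B (w (m + 1) - w m) = B (w (m + 1)) - B (w m) := map_sub _ _ _
    have e2 : A (w (m + 1) - w m) = A (w (m + 1)) - A (w m) := map_sub _ _ _
    have e3 : B (f (m + 1) - f m) = B (f (m + 1)) - B (f m) := map_sub _ _ _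
    generalize w (m + 1) - w m = d at *
    rw [e3]
    rw [e2] at hp
    simp only [LinearMap.sub_apply] at *
    have e4 : τ * (τ⁻¹ * (τ⁻¹ * ((B (f (m + 1))) d - (B (f m)) d)))
        = τ⁻¹ * ((B (f (m + 1))) d - (B (f m)) d) := by field_simp
    rw [e4]
    have h3 := congrArg (τ⁻¹ * ·) h
    have h4 := congrArg (τ⁻¹ * ·) h'
    nlinarith

/-- The dissipation bound, from testing with the difference quotient of the solution. -/
theorem dissipation_le_sum_of_euler (hB : ∀ v, 0 ≤ B v v) (hBs : ∀ u v, B u v = B v u)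
    (hA : ∀ v, 0 ≤ A v v) (hAs : ∀ u v, A u v = A v u)
    {w f : ℕ → V} {τ μ : ℝ} {N : ℕ} (hτ : 0 < τ) (hμ : 0 < μ) (h0 : A (w 0) (w 0) = 0)
    (hw : ∀ n ∈ Finset.Icc 1 N,
      B (τ⁻¹ • (w n - w (n - 1))) (w n - w (n - 1)) + μ * A (w n) (w n - w (n - 1))
        = B (f n) (w n - w (n - 1))) :
    ∀ m ≤ N, μ * A (w m) (w m) ≤ ∑ n ∈ Finset.Icc 1 m, τ * B (f n) (f n) := by
  intro m
  induction m with
  | zero => intro _; simp [h0]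
  | succ m ih =>
    intro hm
    rw [Finset.sum_Icc_succ_top (by omega)]
    have ih := ih (by omega)
    have h := hw (m + 1) (by simp; omega)
    have hp := mul_nonneg hμ.le (hA (w (m + 1) - w m))
    -- `0 ≤ ‖2 d - τ f‖²` for the increment `d` is the inequality `f d - d² / τ ≤ τ f² / 4`
    have hq := hB ((2 : ℝ) • (w (m + 1) - w m) - τ • f (m + 1))
    have hf := mul_nonneg hτ.le (hB (f (m + 1)))
    have hs := hAs (w m) (w (m + 1))
    simp only [add_tsub_cancel_right] at h
    have hm2 : A (w (m + 1) - w m) (w (m + 1) - w m)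
      = 2 * A (w (m + 1)) (w (m + 1) - w m) - A (w (m + 1)) (w (m + 1)) + A (w m) (w m) := by
      simp only [map_sub, LinearMap.sub_apply]
      linarith
    rw [hm2] at hp
    generalize w (m + 1) - w m = d at *
    have hs2 := hBs d (f (m + 1))
    simp only [map_smul, map_sub, LinearMap.smul_apply, LinearMap.sub_apply, smul_eq_mul,
      ← hs2] at hq h
    have h3 := congrArg (τ * ·) h
    simp only [mul_add, ← mul_assoc, mul_inv_cancel₀ hτ.ne', one_mul] at h3
    have hq' : 0 ≤ 4 * B d d - 4 * (τ * B d (f (m + 1))) + τ * (τ * B (f (m + 1)) (f (m + 1))) := by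
      nlinarith
    have : 0 ≤ τ * (4 * (τ⁻¹ * B d d) - 4 * B d (f (m + 1)) + τ * B (f (m + 1)) (f (m + 1))) := by
      have e : τ * (4 * (τ⁻¹ * B d d) - 4 * B d (f (m + 1)) + τ * B (f (m + 1)) (f (m + 1)))
        = 4 * B d d - 4 * (τ * B d (f (m + 1))) + τ * (τ * B (f (m + 1)) (f (m + 1))) := by
        field_simp
      rw [e]; exact hq'
    have := nonneg_of_mul_nonneg_right this hτ
    nlinarith

end Energy

/-! ### Summation by parts -/

theorem sum_Ico_sub_mul_eq {N : ℕ} (hN : 0 < N) (a v : ℕ → ℝ) (h0 : v 0 = 0) (hv : v N = 0) :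
    ∑ i ∈ Finset.Ico 1 N, (a i - a (i - 1)) * v i
      = -∑ i ∈ Finset.range N, a i * (v (i + 1) - v i) := by
  have key : ∀ n, ∑ i ∈ Finset.Ico 1 (n + 1), (a i - a (i - 1)) * v i
      = a n * v (n + 1) - a 0 * v 0 - ∑ i ∈ Finset.range (n + 1), a i * (v (i + 1) - v i) := by
    intro n
    induction n with
    | zero => simp; ring
    | succ n ih =>
      rw [Finset.sum_Ico_succ_top (by omega), ih, Finset.sum_range_succ _ (n + 1)]
      simp only [add_tsub_cancel_right]
      ring
  obtain ⟨n, rfl⟩ : ∃ n, N = n + 1 := ⟨N - 1, by omega⟩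
  rw [key, h0, hv]
  ring

/-- Summation by parts from the midpoints to all grid points, for a function `v` of the doubled
index that vanishes at both ends. -/
theorem sum_range_sub_mul_eq {N : ℕ} (hN : 0 < N) (a v : ℕ → ℝ) (h0 : v 0 = 0)
    (hv : v (2 * N) = 0) :
    ∑ j ∈ Finset.range N, (a (j + 1) - a j) * v (2 * j + 1)
      = -∑ j ∈ Finset.range (N + 1), a j * (v (min (2 * j + 1) (2 * N)) - v (2 * j - 1)) := by
  have key : ∀ n, ∑ j ∈ Finset.range (n + 1), (a (j + 1) - a j) * v (2 * j + 1)
      = a (n + 1) * v (2 * n + 1)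
        - ∑ j ∈ Finset.range (n + 1), a j * (v (2 * j + 1) - v (2 * j - 1)) := by
    intro n
    induction n with
    | zero => simp [h0]; ring
    | succ n ih =>
      rw [Finset.sum_range_succ, ih, Finset.sum_range_succ _ (n + 1)]
      rw [show 2 * (n + 1) - 1 = 2 * n + 1 by omega]
      ring
  obtain ⟨n, rfl⟩ : ∃ n, N = n + 1 := ⟨N - 1, by omega⟩
  rw [key, Finset.sum_range_succ _ (n + 1), min_eq_right (by omega), hv,
    show 2 * (n + 1) - 1 = 2 * n + 1 by omega]
  have e : ∀ j ∈ Finset.range (n + 1), a j * (v (min (2 * j + 1) (2 * (n + 1))) - v (2 * j - 1))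
      = a j * (v (2 * j + 1) - v (2 * j - 1)) := fun j hj => by
    rw [min_eq_left (by have := Finset.mem_range.mp hj; omega)]
  rw [Finset.sum_congr rfl e]
  ring

/-! ### Geometry of the grids -/

namespace Grid1D

variable {L : ℝ} (G : Grid1D L)

theorem pt_even (i : ℕ) : G.pt (2 * i) = G.node i := by
  unfold pt
  rw [show 2 * i / 2 = i by omega, show (2 * i + 1) / 2 = i by omega]
  ring

theorem pt_odd (i : ℕ) : G.pt (2 * i + 1) = (G.node i + G.node (i + 1)) / 2 := by
  unfold pt
  rw [show (2 * i + 1) / 2 = i by omega, show (2 * i + 1 + 1) / 2 = i + 1 by omega]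

theorem cell_pos {i : ℕ} (hi : i < G.num) : 0 < G.cell i :=
  sub_pos.mpr (G.node_lt i hi)

theorem dual_eq {i : ℕ} (hi : i ∈ Finset.Ico 1 G.num) :
    G.dual i = (G.cell i + G.cell (i - 1)) / 2 := by
  obtain ⟨h1, h2⟩ := Finset.mem_Ico.mp hi
  rw [dual, if_pos h2, if_pos (by omega)]

theorem dual_pos {i : ℕ} (hi : i ∈ Finset.Ico 1 G.num) : 0 < G.dual i := by
  obtain ⟨h1, h2⟩ := Finset.mem_Ico.mp hi
  rw [G.dual_eq hi]
  linarith [G.cell_pos h2, G.cell_pos (i := i - 1) (by omega)]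

theorem dual_nonneg (i : ℕ) (hi : i ≤ G.num) : 0 ≤ G.dual i := by
  unfold dual
  split_ifs with h1 h2 h2
  · linarith [G.cell_pos h1, G.cell_pos (i := i - 1) (by omega)]
  · linarith [G.cell_pos h1]
  · linarith [G.cell_pos (i := i - 1) (by omega)]
  · simp

theorem node_le {i j : ℕ} (hij : i ≤ j) (hj : j ≤ G.num) : G.node i ≤ G.node j := by
  induction j, hij using Nat.le_induction with
  | base => exact le_rfl
  | succ j _ ih => exact (ih (by omega)).trans (G.node_lt j (by omega)).le

theorem pt_le {a b : ℕ} (hab : a ≤ b) (hb : b ≤ 2 * G.num) : G.pt a ≤ G.pt b := by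
  unfold pt
  linarith [G.node_le (i := a / 2) (j := b / 2) (by omega) (by omega),
    G.node_le (i := (a + 1) / 2) (j := (b + 1) / 2) (by omega) (by omega)]

theorem length_pos {L : ℝ} (G : Grid1D L) : 0 < L := by
  have h1 := G.node_lt 0 G.num_pos
  have h2 := G.node_le (i := 1) G.num_pos le_rfl
  rw [G.node_last] at h2
  rw [G.node_zero] at h1
  exact h1.trans_le h2

theorem pt_lt {a b : ℕ} (hab : a < b) (hb : b ≤ 2 * G.num) : G.pt a < G.pt b := by
  unfold pt
  have h1 := G.node_le (i := a / 2) (j := b / 2) (by omega) (by omega)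
  have h2 := G.node_le (i := (a + 1) / 2) (j := (b + 1) / 2) (by omega) (by omega)
  rcases Nat.even_or_odd' a with ⟨c, rfl | rfl⟩
  · have h3 := G.node_lt c (by omega)
    have h4 := G.node_le (i := c + 1) (j := (b + 1) / 2) (by omega) (by omega)
    rw [show (2 * c + 1) / 2 = c by omega] at *
    linarith
  · have h3 := G.node_lt c (by omega)
    have h4 := G.node_le (i := c + 1) (j := b / 2) (by omega) (by omega)
    rw [show (2 * c + 1) / 2 = c by omega] at *
    linarith

theorem pt_zero : G.pt 0 = 0 := by rw [show 0 = 2 * 0 from rfl, G.pt_even, G.node_zero]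

theorem pt_last : G.pt (2 * G.num) = L := by rw [G.pt_even, G.node_last]

/-- The point `pt a` in the affine coordinate that maps `[0, L]` to `[-1, 1]`. -/
noncomputable def ref (a : ℕ) : ℝ := 2 * G.pt a / L - 1

theorem ref_zero : G.ref 0 = -1 := by simp [ref, G.pt_zero]

theorem ref_last : G.ref (2 * G.num) = 1 := by
  have := G.length_pos
  rw [ref, G.pt_last]
  field_simp
  norm_num

theorem ref_le {a b : ℕ} (hab : a ≤ b) (hb : b ≤ 2 * G.num) : G.ref a ≤ G.ref b := by
  have := G.length_pos
  have := G.pt_le hab hb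
  unfold ref
  gcongr

theorem abs_ref_le {a : ℕ} (ha : a ≤ 2 * G.num) : |G.ref a| ≤ 1 := by
  rw [abs_le]
  have h1 := G.ref_le (Nat.zero_le a) ha
  have h2 := G.ref_le ha le_rfl
  rw [ref_zero] at h1
  rw [ref_last] at h2
  exact ⟨h1, h2⟩

theorem cell_eq (i : ℕ) : G.cell i = L / 2 * (G.ref (2 * i + 2) - G.ref (2 * i)) := by
  have := G.length_pos.ne'
  rw [ref, ref, show 2 * i + 2 = 2 * (i + 1) by ring, pt_even, pt_even, cell]
  field_simp
  ring

theorem ref_odd (i : ℕ) : G.ref (2 * i + 1) = (G.ref (2 * i) + G.ref (2 * i + 2)) / 2 := by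
  have := G.length_pos.ne'
  rw [ref, ref, ref, show 2 * i + 2 = 2 * (i + 1) by ring, pt_even, pt_even, pt_odd]
  field_simp
  ring

theorem sum_cell_eq_node (n : ℕ) : ∑ i ∈ Finset.range n, G.cell i = G.node n := by
  simp only [cell, Finset.sum_range_sub, G.node_zero, sub_zero]

theorem sum_cell : ∑ i ∈ Finset.range G.num, G.cell i = L := by
  rw [sum_cell_eq_node, node_last]

theorem sum_cell_mul_add (r : ℕ → ℝ) :
    ∑ i ∈ Finset.range G.num, G.cell i * (r i + r (i + 1))
      = 2 * ∑ i ∈ Finset.range (G.num + 1), G.dual i * r i := by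
  have h1 : ∑ i ∈ Finset.range (G.num + 1), (if i < G.num then G.cell i else 0) * r i
      = ∑ i ∈ Finset.range G.num, G.cell i * r i := by
    rw [Finset.sum_range_succ]
    simp only [lt_irrefl, if_false, zero_mul, add_zero]
    exact Finset.sum_congr rfl fun i hi => by rw [if_pos (Finset.mem_range.mp hi)]
  have h2 : ∑ i ∈ Finset.range (G.num + 1), (if 0 < i then G.cell (i - 1) else 0) * r i
      = ∑ i ∈ Finset.range G.num, G.cell i * r (i + 1) := by
    rw [Finset.sum_range_succ']
    simp
  simp only [mul_add, Finset.sum_add_distrib]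
  rw [← h1, ← h2, ← Finset.sum_add_distrib, Finset.mul_sum]
  exact Finset.sum_congr rfl fun i _ => by rw [dual]; ring

theorem sum_dual_le : ∑ i ∈ Finset.Ico 1 G.num, G.dual i ≤ L := by
  have h := G.sum_cell_mul_add fun _ => 1
  simp only [mul_one] at h
  rw [show (1 : ℝ) + 1 = 2 by norm_num, ← Finset.sum_mul, G.sum_cell] at h
  have : ∑ i ∈ Finset.Ico 1 G.num, G.dual i ≤ ∑ i ∈ Finset.range (G.num + 1), G.dual i :=
    Finset.sum_le_sum_of_subset_of_nonneg
      (fun i hi => by simp only [Finset.mem_Ico, Finset.mem_range] at *; omega)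
      fun i hi _ => G.dual_nonneg i (by simp at hi; omega)
  linarith

/-- On a regular grid, a dual cell has at most `c` times the length of each of the two cells that
it meets. -/
theorem sum_dual_mul_le {c : ℝ}
    (hreg : ∀ i ∈ Finset.Ico 1 G.num, G.dual i ≤ c * G.cell i ∧ G.dual i ≤ c * G.cell (i - 1))
    (s : ℕ → ℝ) (hs : ∀ i, 0 ≤ s i) (hc : 0 ≤ c) :
    ∑ i ∈ Finset.Ico 1 G.num, G.dual i * (s i + s (i - 1))
      ≤ 2 * c * ∑ i ∈ Finset.range G.num, G.cell i * s i := by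
  have hn (i : ℕ) (hi : i ∈ Finset.range G.num) : 0 ≤ G.cell i * s i :=
    mul_nonneg (G.cell_pos (Finset.mem_range.mp hi)).le (hs i)
  have h1 : ∑ i ∈ Finset.Ico 1 G.num, G.cell i * s i
      ≤ ∑ i ∈ Finset.range G.num, G.cell i * s i :=
    Finset.sum_le_sum_of_subset_of_nonneg
      (fun i hi => by simp only [Finset.mem_Ico, Finset.mem_range] at *; omega)
      fun i hi _ => hn i hi
  have h2 : ∑ i ∈ Finset.Ico 1 G.num, G.cell (i - 1) * s (i - 1)
      ≤ ∑ i ∈ Finset.range G.num, G.cell i * s i := by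
    rw [Finset.sum_Ico_eq_sum_range]
    simp only [add_tsub_cancel_left]
    exact Finset.sum_le_sum_of_subset_of_nonneg
      (fun i hi => by simp only [Finset.mem_range] at *; omega) fun i hi _ => hn i hi
  calc ∑ i ∈ Finset.Ico 1 G.num, G.dual i * (s i + s (i - 1))
      ≤ ∑ i ∈ Finset.Ico 1 G.num, c * (G.cell i * s i + G.cell (i - 1) * s (i - 1)) := by
        refine Finset.sum_le_sum fun i hi => ?_
        obtain ⟨h1, h2⟩ := hreg i hi
        nlinarith [mul_le_mul_of_nonneg_right h1 (hs i),
          mul_le_mul_of_nonneg_right h2 (hs (i - 1))]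
    _ = c * (∑ i ∈ Finset.Ico 1 G.num, G.cell i * s i
          + ∑ i ∈ Finset.Ico 1 G.num, G.cell (i - 1) * s (i - 1)) := by
        rw [← Finset.mul_sum, Finset.sum_add_distrib]
    _ ≤ _ := by nlinarith

end Grid1D

theorem IsRegular.dual_le_x {Lx Ly C₀ : ℝ} {Gx : Grid1D Lx} {Gy : Grid1D Ly}
    (h : IsRegular Gx Gy C₀) (hC₀ : 0 < C₀) :
    ∀ i ∈ Finset.Ico 1 Gx.num,
      Gx.dual i ≤ 1 / C₀ * Gx.cell i ∧ Gx.dual i ≤ 1 / C₀ * Gx.cell (i - 1) := by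
  intro i hi
  obtain ⟨h1, h2⟩ := Finset.mem_Ico.mp hi
  have m (l : ℕ) (hl : l < Gx.num) :
      Gx.cell l ∈ Gx.cell '' Set.Iio Gx.num ∪ Gy.cell '' Set.Iio Gy.num :=
    Or.inl ⟨l, hl, rfl⟩
  have m1 := m i h2
  have m2 := m (i - 1) (by omega)
  have a1 := h _ m1 _ m1
  have a2 := h _ m1 _ m2
  have a3 := h _ m2 _ m1
  have a4 := h _ m2 _ m2
  rw [Gx.dual_eq hi, div_mul_eq_mul_div, div_mul_eq_mul_div, le_div_iff₀ hC₀, le_div_iff₀ hC₀]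
  constructor <;> linarith

theorem IsRegular.swap {Lx Ly C₀ : ℝ} {Gx : Grid1D Lx} {Gy : Grid1D Ly}
    (h : IsRegular Gx Gy C₀) : IsRegular Gy Gx C₀ :=
  fun a ha b hb => h a ha.symm b hb.symm

/-! ### Exchanging the two coordinate directions -/

/-- The discrete function with its two arguments exchanged. -/
def GridFun.swap (φ : GridFun) : GridFun := fun a b => φ b a

section Operators

variable {Lx Ly : ℝ} (Gx : Grid1D Lx) (Gy : Grid1D Ly)

theorem innerM_swap (f g : GridFun) : innerM Gy Gx f.swap g.swap = innerM Gx Gy f g := by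
  unfold innerM
  rw [Finset.sum_comm]
  simp only [GridFun.swap, mul_comm (Gy.cell _) (Gx.cell _)]

theorem innerTM_swap (f g : GridFun) : innerTM Gy Gx f.swap g.swap = innerMT Gx Gy f g := by
  unfold innerTM innerMT
  rw [Finset.sum_comm]
  simp only [GridFun.swap, mul_comm (Gy.dual _) (Gx.cell _)]

/-- The difference quotient `D_x` as a discrete function on the points `(x_i, y_{j+1/2})`. -/
noncomputable def gradX (φ : GridFun) : GridFun := fun a b => Dx Gx φ (a / 2) b

/-- The difference quotient `D_y` as a discrete function on the points `(x_{i+1/2}, y_j)`. -/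
noncomputable def gradY (φ : GridFun) : GridFun := fun a b => Dy Gy φ a (b / 2)

theorem gradX_apply (φ : GridFun) {i : ℕ} (hi : i ∈ Finset.Ico 1 Gx.num) (b : ℕ) :
    gradX Gx φ (2 * i) b = (φ (2 * i + 1) b - φ (2 * i - 1) b) / Gx.dual i := by
  obtain ⟨h1, h2⟩ := Finset.mem_Ico.mp hi
  rw [gradX, Dx, Nat.mul_div_cancel_left _ two_pos, min_eq_left (by omega)]

theorem gradX_swap (φ : GridFun) : gradX Gy φ.swap = (gradY Gy φ).swap := rfl

/-- The distance to the boundary in the maximum norm, after the domain has been mapped to the square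
`[-1, 1]²`; a function on all points of the staggered grid. -/
noncomputable def cutoff : GridFun := fun a b => 1 - max |Gx.ref a| |Gy.ref b|

theorem cutoff_swap : cutoff Gy Gx = (cutoff Gx Gy).swap := by
  funext a b
  rw [GridFun.swap, cutoff, cutoff, max_comm]

end Operators

/-! ### A Hardy inequality on the grid -/

/-- The first component of the vector field `-d(z) z` on the square `[-1, 1]²`, where `z = (x, e)`
and `d(z) = 1 - max |x| |e|` is the distance to the boundary. -/
noncomputable def inwardField (e x : ℝ) : ℝ := -(x * (1 - max |x| |e|))

/-- The field vanishes on the boundary and decreases in `x` at a rate of at most `1 - |e|`. -/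
theorem inwardField_sub_ge {a b : ℝ} (e : ℝ) (hab : a ≤ b) :
    (b - a) * (|e| - 1) ≤ inwardField e b - inwardField e a := by
  have key : (b - a) * |e| ≤ b * max |b| |e| - a * max |a| |e| := by
    have he := abs_nonneg e
    generalize |e| = t at *
    rcases abs_cases a with ⟨h5, h6⟩ | ⟨h5, h6⟩ <;>
    rcases abs_cases b with ⟨h7, h8⟩ | ⟨h7, h8⟩ <;>
    rw [h5, h7] <;> simp only [max_def] <;> split_ifs <;> nlinarith
  unfold inwardField
  nlinarith

theorem inwardField_sub_ge_of_pos {a b : ℝ} {e : ℝ} (hab : a ≤ b) (hb : b ≤ 1)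
    (hm : 1 / 2 ≤ (a + b) / 2) (he : |e| ≤ (a + b) / 2) :
    (b - a) * (3 / 2 * ((a + b) / 2) - 1) ≤ inwardField e b - inwardField e a := by
  have ha : 0 ≤ a := by linarith
  have hb0 : 0 ≤ b := ha.trans hab
  have key : (b - a) * (3 / 2 * ((a + b) / 2)) ≤ b * max |b| |e| - a * max |a| |e| := by
    rw [abs_of_nonneg ha, abs_of_nonneg hb0, max_eq_left (by linarith : |e| ≤ b)]
    have : max a |e| ≤ (a + b) / 2 := max_le (by linarith) he
    nlinarith [mul_le_mul_of_nonneg_left this ha]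
  unfold inwardField
  nlinarith

/-- Where `|x|` dominates, the field increases in `x` near the boundary; only the midpoint of the
interval has to lie where `|x|` dominates. -/
theorem inwardField_sub_ge_of_abs {a b : ℝ} {e : ℝ} (hab : a ≤ b) (ha : -1 ≤ a) (hb : b ≤ 1)
    (hm : 1 / 2 ≤ |(a + b) / 2|) (he : |e| ≤ |(a + b) / 2|) :
    (b - a) * (3 / 2 * |(a + b) / 2| - 1) ≤ inwardField e b - inwardField e a := by
  rcases abs_cases ((a + b) / 2) with ⟨h1, h2⟩ | ⟨h1, h2⟩
  · rw [h1] at hm he ⊢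
    exact inwardField_sub_ge_of_pos hab hb hm he
  · rw [h1] at hm he ⊢
    have h := inwardField_sub_ge_of_pos (a := -b) (b := -a) (e := e) (by linarith) (by linarith)
      (by linarith) (by linarith)
    simp only [inwardField, abs_neg] at h ⊢
    have e1 : (-b + -a) / 2 = -((a + b) / 2) := by ring
    rw [e1] at h
    linarith

/-- The discrete divergence of the field `-d(z) z` on the cell `[a, b] × [c, d]` is at least `1 / 4`
if the midpoint of the cell is close to the boundary, and at least `-2` on every cell. This needs no
bound on the size of the cell, which may meet the diagonals, where the field has a kink. -/
theorem div_inwardField_ge {a b c d : ℝ} (hab : a < b) (hcd : c < d) (ha : -1 ≤ a) (hb : b ≤ 1)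
    (hc : -1 ≤ c) (hd : d ≤ 1) :
    1 / 4 - (if |(a + b) / 2| < 9 / 10 ∧ |(c + d) / 2| < 9 / 10 then 9 / 4 else 0)
      ≤ (inwardField ((c + d) / 2) b - inwardField ((c + d) / 2) a) / (b - a)
        + (inwardField ((a + b) / 2) d - inwardField ((a + b) / 2) c) / (d - c) := by
  have hab' : 0 < b - a := sub_pos.mpr hab
  have hcd' : 0 < d - c := sub_pos.mpr hcd
  have x1 := inwardField_sub_ge ((c + d) / 2) hab.le
  have y1 := inwardField_sub_ge ((a + b) / 2) hcd.le
  have x2 := inwardField_sub_ge_of_abs (e := (c + d) / 2) hab.le ha hb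
  have y2 := inwardField_sub_ge_of_abs (e := (a + b) / 2) hcd.le hc hd
  rw [mul_comm, ← le_div_iff₀ hab'] at x1
  rw [mul_comm, ← le_div_iff₀ hcd'] at y1
  have n1 := abs_nonneg ((a + b) / 2)
  have n2 := abs_nonneg ((c + d) / 2)
  split_ifs with h
  · linarith
  · by_cases h1 : |(a + b) / 2| < 9 / 10
    · have h2 : 9 / 10 ≤ |(c + d) / 2| := not_lt.mp fun h2 => h ⟨h1, h2⟩
      have y3 := y2 (by linarith) (by linarith)
      rw [mul_comm, ← le_div_iff₀ hcd'] at y3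
      linarith
    · rw [not_lt] at h1
      rcases le_total |(c + d) / 2| |(a + b) / 2| with h2 | h2
      · have x3 := x2 (by linarith) h2
        rw [mul_comm, ← le_div_iff₀ hab'] at x3
        linarith
      · have y3 := y2 (by linarith) h2
        rw [mul_comm, ← le_div_iff₀ hcd'] at y3
        linarith

section Operators

variable {Lx Ly : ℝ} (Gx : Grid1D Lx) (Gy : Grid1D Ly)

/-- The square of the norm of the gradient of a cell function, weighted with the distance to the
boundary, in the `x` direction. -/
noncomputable def weightedX (q : GridFun) : ℝ :=
  innerTM Gx Gy (fun a b => cutoff Gx Gy a b * gradX Gx q a b)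
    (fun a b => cutoff Gx Gy a b * gradX Gx q a b)

/-- The square of the norm of the gradient of a cell function, weighted with the distance to the
boundary, in the `y` direction. -/
noncomputable def weightedY (q : GridFun) : ℝ :=
  innerMT Gx Gy (fun a b => cutoff Gx Gy a b * gradY Gy q a b)
    (fun a b => cutoff Gx Gy a b * gradY Gy q a b)

theorem weightedX_swap (q : GridFun) : weightedX Gy Gx q.swap = weightedY Gx Gy q := by
  unfold weightedX weightedY
  rw [← innerTM_swap, cutoff_swap, gradX_swap]
  rfl

/-- The outward flux of the field `-d(z) z`, scaled to the domain, through the two sides of a cell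
that are orthogonal to the `x` direction; `fluxX Gy Gx j i` is the flux through the other two. -/
noncomputable def fluxX (i j : ℕ) : ℝ :=
  Gy.cell j * (Lx / 2 * (inwardField (Gy.ref (2 * j + 1)) (Gx.ref (2 * i + 2))
    - inwardField (Gy.ref (2 * j + 1)) (Gx.ref (2 * i))))

theorem flux_ge {i j : ℕ} (hi : i < Gx.num) (hj : j < Gy.num) :
    Gx.cell i * Gy.cell j * (1 / 4 -
      (if |Gx.ref (2 * i + 1)| < 9 / 10 ∧ |Gy.ref (2 * j + 1)| < 9 / 10 then 9 / 4 else 0))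
      ≤ fluxX Gx Gy i j + fluxX Gy Gx j i := by
  have hx := Gx.cell_pos hi
  have hy := Gy.cell_pos hj
  have Lx0 := Gx.length_pos
  have Ly0 := Gy.length_pos
  have ex := Gx.cell_eq i
  have ey := Gy.cell_eq j
  have dx0 : 0 < Gx.ref (2 * i + 2) - Gx.ref (2 * i) :=
    pos_of_mul_pos_right (ex ▸ hx) (by positivity)
  have dy0 : 0 < Gy.ref (2 * j + 2) - Gy.ref (2 * j) :=
    pos_of_mul_pos_right (ey ▸ hy) (by positivity)
  have h := div_inwardField_ge (sub_pos.mp dx0) (sub_pos.mp dy0)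
    (abs_le.mp (Gx.abs_ref_le (a := 2 * i) (by omega))).1
    (abs_le.mp (Gx.abs_ref_le (a := 2 * i + 2) (by omega))).2
    (abs_le.mp (Gy.abs_ref_le (a := 2 * j) (by omega))).1
    (abs_le.mp (Gy.abs_ref_le (a := 2 * j + 2) (by omega))).2
  rw [← Gx.ref_odd, ← Gy.ref_odd] at h
  refine (mul_le_mul_of_nonneg_left h (mul_pos hx hy).le).trans_eq ?_
  unfold fluxX
  rw [ex, ey]
  field_simp

/-- Summation by parts against the inward field, whose size is at most the distance to the
boundary. -/
theorem sum_fluxX_mul_sq_le {c ε : ℝ} (hc : 0 ≤ c) (hε : 0 < ε)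
    (hreg : ∀ i ∈ Finset.Ico 1 Gx.num,
      Gx.dual i ≤ c * Gx.cell i ∧ Gx.dual i ≤ c * Gx.cell (i - 1)) (s : GridFun) :
    ∑ i ∈ Finset.range Gx.num, ∑ j ∈ Finset.range Gy.num,
        fluxX Gx Gy i j * s (2 * i + 1) (2 * j + 1) ^ 2
      ≤ Lx ^ 2 / (8 * ε) * weightedX Gx Gy s + 2 * c * ε * innerM Gx Gy s s := by
  have L0 := Gx.length_pos
  have slice : ∀ j ∈ Finset.range Gy.num,
      ∑ i ∈ Finset.range Gx.num, (Lx / 2 * (inwardField (Gy.ref (2 * j + 1)) (Gx.ref (2 * i + 2))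
        - inwardField (Gy.ref (2 * j + 1)) (Gx.ref (2 * i)))) * s (2 * i + 1) (2 * j + 1) ^ 2
      ≤ Lx ^ 2 / (8 * ε) * ∑ i ∈ Finset.Ico 1 Gx.num,
          Gx.dual i * (cutoff Gx Gy (2 * i) (2 * j + 1) * gradX Gx s (2 * i) (2 * j + 1)) ^ 2
        + 2 * c * ε * ∑ i ∈ Finset.range Gx.num, Gx.cell i * s (2 * i + 1) (2 * j + 1) ^ 2 := by
    intro j hj
    have hj := Finset.mem_range.mp hj
    have he : |Gy.ref (2 * j + 1)| ≤ 1 := Gy.abs_ref_le (by omega)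
    have parts := sum_Ico_sub_mul_eq Gx.num_pos (fun i => s (2 * i + 1) (2 * j + 1) ^ 2)
      (fun i => Lx / 2 * inwardField (Gy.ref (2 * j + 1)) (Gx.ref (2 * i)))
      (by simp [inwardField, Gx.ref_zero, he]) (by simp [inwardField, Gx.ref_last, he])
    have e1 : ∑ i ∈ Finset.range Gx.num,
        (Lx / 2 * (inwardField (Gy.ref (2 * j + 1)) (Gx.ref (2 * i + 2))
        - inwardField (Gy.ref (2 * j + 1)) (Gx.ref (2 * i)))) * s (2 * i + 1) (2 * j + 1) ^ 2
        = ∑ i ∈ Finset.Ico 1 Gx.num,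
          -((s (2 * i + 1) (2 * j + 1) ^ 2 - s (2 * (i - 1) + 1) (2 * j + 1) ^ 2)
            * (Lx / 2 * inwardField (Gy.ref (2 * j + 1)) (Gx.ref (2 * i)))) := by
      rw [Finset.sum_neg_distrib, parts, neg_neg]
      refine Finset.sum_congr rfl fun i _ => ?_
      rw [show 2 * (i + 1) = 2 * i + 2 by ring]
      ring
    rw [e1]
    have h2 := Gx.sum_dual_mul_le hreg (fun i => s (2 * i + 1) (2 * j + 1) ^ 2)
      (fun i => sq_nonneg _) hc
    calc _ ≤ ∑ i ∈ Finset.Ico 1 Gx.num, (Lx ^ 2 / (8 * ε) * (Gx.dual i *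
            (cutoff Gx Gy (2 * i) (2 * j + 1) * gradX Gx s (2 * i) (2 * j + 1)) ^ 2)
          + ε * (Gx.dual i * (s (2 * i + 1) (2 * j + 1) ^ 2
            + s (2 * (i - 1) + 1) (2 * j + 1) ^ 2))) := by
          refine Finset.sum_le_sum fun i hi => ?_
          have hd := Gx.dual_pos hi
          rw [gradX_apply _ _ hi]
          obtain ⟨hi1, hi2⟩ := Finset.mem_Ico.mp hi
          rw [show 2 * i - 1 = 2 * (i - 1) + 1 by omega]
          have hx : |Gx.ref (2 * i)| ≤ 1 := Gx.abs_ref_le (by omega)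
          unfold inwardField cutoff
          generalize max |Gx.ref (2 * i)| |Gy.ref (2 * j + 1)| = ρ
          generalize Gx.ref (2 * i) = x at *
          generalize s (2 * i + 1) (2 * j + 1) = u
          generalize s (2 * (i - 1) + 1) (2 * j + 1) = v
          have hx2 : x ^ 2 ≤ 1 := (sq_le_one_iff_abs_le_one x).mpr hx
          obtain ⟨w, rfl⟩ : ∃ w, u = v + Gx.dual i * w :=
            ⟨(u - v) / Gx.dual i, by field_simp; ring⟩
          have ew : (v + Gx.dual i * w - v) / Gx.dual i = w := by field_simp; ring
          rw [ew]
          generalize Gx.dual i = D at *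
          have e3 : -(((v + D * w) ^ 2 - v ^ 2) * (Lx / 2 * -(x * (1 - ρ))))
            = D * ((Lx * ((1 - ρ) * w)) * (x * (v + D * w + v)) / 2) := by ring
          rw [e3]
          have e4 : Lx ^ 2 / (8 * ε) * (D * ((1 - ρ) * w) ^ 2) + ε * (D * ((v + D * w) ^ 2 + v ^ 2))
            = D * ((Lx * ((1 - ρ) * w)) ^ 2 / (8 * ε) + ε * ((v + D * w) ^ 2 + v ^ 2)) := by
            ring
          rw [e4]
          refine mul_le_mul_of_nonneg_left ?_ hd.le
          generalize Lx * ((1 - ρ) * w) = A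
          generalize v + D * w = u
          have h5 : A * (x * (u + v)) / 2 ≤ A ^ 2 / (8 * ε) + ε * (x * (u + v)) ^ 2 / 2 := by
            rw [← sub_nonneg]
            have : A ^ 2 / (8 * ε) + ε * (x * (u + v)) ^ 2 / 2 - A * (x * (u + v)) / 2
              = (A - 2 * ε * (x * (u + v))) ^ 2 / (8 * ε) := by field_simp; ring
            rw [this]; positivity
          have h6 : (x * (u + v)) ^ 2 ≤ 2 * (u ^ 2 + v ^ 2) := by
            nlinarith [sq_nonneg (u - v), mul_le_mul_of_nonneg_right hx2 (sq_nonneg (u + v))]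
          nlinarith [mul_le_mul_of_nonneg_left h6 hε.le]
      _ = Lx ^ 2 / (8 * ε) * ∑ i ∈ Finset.Ico 1 Gx.num,
            Gx.dual i * (cutoff Gx Gy (2 * i) (2 * j + 1) * gradX Gx s (2 * i) (2 * j + 1)) ^ 2
          + ε * ∑ i ∈ Finset.Ico 1 Gx.num, Gx.dual i * (s (2 * i + 1) (2 * j + 1) ^ 2
            + s (2 * (i - 1) + 1) (2 * j + 1) ^ 2) := by
          rw [Finset.sum_add_distrib, Finset.mul_sum, Finset.mul_sum]
      _ ≤ _ := by
          have := mul_le_mul_of_nonneg_left h2 hε.le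
          linarith
  rw [Finset.sum_comm]
  calc _ ≤ ∑ j ∈ Finset.range Gy.num, Gy.cell j * (Lx ^ 2 / (8 * ε) * ∑ i ∈ Finset.Ico 1 Gx.num,
          Gx.dual i * (cutoff Gx Gy (2 * i) (2 * j + 1) * gradX Gx s (2 * i) (2 * j + 1)) ^ 2
        + 2 * c * ε * ∑ i ∈ Finset.range Gx.num, Gx.cell i * s (2 * i + 1) (2 * j + 1) ^ 2) := by
        refine Finset.sum_le_sum fun j hj => ?_
        refine le_trans (le_of_eq ?_) (mul_le_mul_of_nonneg_left (slice j hj)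
          (Gy.cell_pos (Finset.mem_range.mp hj)).le)
        rw [Finset.mul_sum]
        exact Finset.sum_congr rfl fun i _ => by rw [fluxX]; ring
    _ = _ := by
        unfold weightedX innerTM innerM
        rw [Finset.sum_comm, Finset.sum_comm (s := Finset.range Gx.num)]
        simp only [mul_add, Finset.sum_add_distrib, Finset.mul_sum]
        congr 1 <;> exact Finset.sum_congr rfl fun j _ => Finset.sum_congr rfl fun i _ => by ring

end Operators

/-! ### The weighted Poincaré inequality -/

/-- If the double sum of the squared differences is at most `(∑ w) * M`, then the values of `q` are
close to one of them, in mean square. -/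
theorem exists_sum_mul_sub_sq_le {ι : Type*} (S : Finset ι) (w q : ι → ℝ) {M : ℝ} (hM : 0 ≤ M)
    (hw : ∀ p ∈ S, 0 < w p)
    (h : ∑ p' ∈ S, w p' * ∑ p ∈ S, w p * (q p - q p') ^ 2 ≤ (∑ p ∈ S, w p) * M) :
    ∃ c, ∑ p ∈ S, w p * (q p - c) ^ 2 ≤ M := by
  rcases S.eq_empty_or_nonempty with rfl | hS
  · exact ⟨0, by simpa using hM⟩
  rw [Finset.sum_mul] at h
  obtain ⟨p, hp, hle⟩ := Finset.exists_le_of_sum_le hS h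
  exact ⟨q p, le_of_mul_le_mul_left hle (hw p hp)⟩

section Operators

variable {Lx Ly : ℝ} (Gx : Grid1D Lx) (Gy : Grid1D Ly)

/-- The cells whose midpoint lies in the inner nine tenths of the interval. -/
noncomputable def Grid1D.inner {L : ℝ} (G : Grid1D L) : Finset ℕ :=
  {i ∈ Finset.range G.num | |G.ref (2 * i + 1)| < 9 / 10}

theorem Grid1D.mem_inner {L : ℝ} {G : Grid1D L} {i : ℕ} :
    i ∈ G.inner ↔ i < G.num ∧ |G.ref (2 * i + 1)| < 9 / 10 := by
  simp [Grid1D.inner]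

/-- The weighted gradient in the `x` direction, on a single row of cells. -/
noncomputable def rowX (q : GridFun) (b : ℕ) : ℝ :=
  ∑ i ∈ Finset.Ico 1 Gx.num, Gx.dual i * (cutoff Gx Gy (2 * i) b * gradX Gx q (2 * i) b) ^ 2

theorem rowX_nonneg (q : GridFun) (b : ℕ) : 0 ≤ rowX Gx Gy q b :=
  Finset.sum_nonneg fun _ hi => mul_nonneg (Gx.dual_pos hi).le (sq_nonneg _)

theorem weightedX_eq (q : GridFun) :
    weightedX Gx Gy q = ∑ j ∈ Finset.range Gy.num, Gy.cell j * rowX Gx Gy q (2 * j + 1) := by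
  unfold weightedX innerTM rowX
  rw [Finset.sum_comm]
  simp only [Finset.mul_sum]
  exact Finset.sum_congr rfl fun j _ => Finset.sum_congr rfl fun i _ => by ring

theorem sq_sub_le_rowX (q : GridFun) {i i' j : ℕ} (hi : i ∈ Gx.inner) (hi' : i' ∈ Gx.inner)
    (hj : j ∈ Gy.inner) :
    (q (2 * i + 1) (2 * j + 1) - q (2 * i' + 1) (2 * j + 1)) ^ 2
      ≤ 100 * Lx * rowX Gx Gy q (2 * j + 1) := by
  wlog hle : i' ≤ i generalizing i i'
  · rw [← neg_sub, neg_sq]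
    exact this hi' hi (le_of_not_ge hle)
  obtain ⟨hi1, hi2⟩ := Grid1D.mem_inner.mp hi
  obtain ⟨hi1', hi2'⟩ := Grid1D.mem_inner.mp hi'
  obtain ⟨hj1, hj2⟩ := Grid1D.mem_inner.mp hj
  have hsub : Finset.Ico (i' + 1) (i + 1) ⊆ Finset.Ico 1 Gx.num := fun l hl => by
    simp only [Finset.mem_Ico] at *; omega
  -- the difference telescopes, and the cutoff is at least `1 / 10` along the way
  have tele : q (2 * i + 1) (2 * j + 1) - q (2 * i' + 1) (2 * j + 1)
      = ∑ l ∈ Finset.Ico (i' + 1) (i + 1), Gx.dual l * gradX Gx q (2 * l) (2 * j + 1) := by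
    have h := Finset.sum_Ico_sub (fun l => q (2 * l + 1) (2 * j + 1)) hle
    rw [← h, Finset.sum_Ico_eq_sum_range, Finset.sum_Ico_eq_sum_range,
      show i + 1 - (i' + 1) = i - i' by omega]
    refine Finset.sum_congr rfl fun l hl => ?_
    have hl := Finset.mem_range.mp hl
    have hm : i' + 1 + l ∈ Finset.Ico 1 Gx.num := by simp only [Finset.mem_Ico]; omega
    rw [gradX_apply _ _ hm, mul_div_cancel₀ _ (Gx.dual_pos hm).ne',
      show 2 * (i' + 1 + l) - 1 = 2 * (i' + l) + 1 by omega,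
      show i' + l + 1 = i' + 1 + l by ring]
  have hcut : ∀ l ∈ Finset.Ico (i' + 1) (i + 1), 1 / 10 ≤ cutoff Gx Gy (2 * l) (2 * j + 1) := by
    intro l hl
    obtain ⟨hl1, hl2⟩ := Finset.mem_Ico.mp hl
    have h1 := Gx.ref_le (a := 2 * i' + 1) (b := 2 * l) (by omega) (by omega)
    have h2 := Gx.ref_le (a := 2 * l) (b := 2 * i + 1) (by omega) (by omega)
    rw [abs_lt] at hi2 hi2'
    have h3 : |Gx.ref (2 * l)| ≤ 9 / 10 := abs_le.mpr ⟨by linarith, by linarith⟩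
    have := max_le h3 hj2.le
    unfold cutoff
    linarith
  rw [tele]
  calc _ ≤ (∑ l ∈ Finset.Ico (i' + 1) (i + 1), Gx.dual l)
        * ∑ l ∈ Finset.Ico (i' + 1) (i + 1),
          100 * (Gx.dual l * (cutoff Gx Gy (2 * l) (2 * j + 1)
            * gradX Gx q (2 * l) (2 * j + 1)) ^ 2) := by
        refine Finset.sum_sq_le_sum_mul_sum_of_sq_le_mul _
          (fun l hl => (Gx.dual_pos (hsub hl)).le)
          (fun l hl => mul_nonneg (by norm_num) (mul_nonneg (Gx.dual_pos (hsub hl)).le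
            (sq_nonneg _))) fun l hl => ?_
        have h1 : 1 ≤ 100 * cutoff Gx Gy (2 * l) (2 * j + 1) ^ 2 := by
          nlinarith [hcut l hl]
        nlinarith [mul_le_mul_of_nonneg_right h1
          (sq_nonneg (Gx.dual l * gradX Gx q (2 * l) (2 * j + 1)))]
    _ ≤ Lx * (100 * rowX Gx Gy q (2 * j + 1)) := by
        have h0 (l : ℕ) (hl : l ∈ Finset.Ico 1 Gx.num) := (Gx.dual_pos hl).le
        refine mul_le_mul ?_ ?_ ?_ Gx.length_pos.le
        · exact (Finset.sum_le_sum_of_subset_of_nonneg hsub fun l hl _ => h0 l hl).trans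
            Gx.sum_dual_le
        · rw [← Finset.mul_sum]
          refine mul_le_mul_of_nonneg_left ?_ (by norm_num)
          exact Finset.sum_le_sum_of_subset_of_nonneg hsub fun l hl _ =>
            mul_nonneg (h0 l hl) (sq_nonneg _)
        · exact Finset.sum_nonneg fun l hl => mul_nonneg (by norm_num)
            (mul_nonneg (h0 l (hsub hl)) (sq_nonneg _))
    _ = _ := by ring

theorem Grid1D.inner_subset {L : ℝ} (G : Grid1D L) : G.inner ⊆ Finset.range G.num :=
  Finset.filter_subset _ _

theorem Grid1D.cell_pos_of_mem_inner {L : ℝ} {G : Grid1D L} {i : ℕ} (hi : i ∈ G.inner) :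
    0 < G.cell i :=
  G.cell_pos (Grid1D.mem_inner.mp hi).1

theorem Grid1D.sum_inner_mul_le {L : ℝ} (G : Grid1D L) (s : ℕ → ℝ) (hs : ∀ i, 0 ≤ s i) :
    ∑ i ∈ G.inner, G.cell i * s i ≤ ∑ i ∈ Finset.range G.num, G.cell i * s i :=
  Finset.sum_le_sum_of_subset_of_nonneg G.inner_subset fun _ hi _ =>
    mul_nonneg (G.cell_pos (Finset.mem_range.mp hi)).le (hs _)

theorem Grid1D.sum_inner_le {L : ℝ} (G : Grid1D L) : ∑ i ∈ G.inner, G.cell i ≤ L := by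
  have h := G.sum_inner_mul_le (fun _ => 1) fun _ => zero_le_one
  simpa [G.sum_cell] using h

theorem weightedX_nonneg (q : GridFun) : 0 ≤ weightedX Gx Gy q := by
  rw [weightedX_eq]
  exact Finset.sum_nonneg fun j hj => mul_nonneg (Gy.cell_pos (Finset.mem_range.mp hj)).le
    (rowX_nonneg Gx Gy q _)

theorem weightedY_nonneg (q : GridFun) : 0 ≤ weightedY Gx Gy q := by
  rw [← weightedX_swap]
  exact weightedX_nonneg Gy Gx _

/-- The Poincaré inequality on the inner part of the domain. -/
theorem exists_sum_inner_sub_sq_le (q : GridFun) :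
    ∃ c, ∑ i ∈ Gx.inner, ∑ j ∈ Gy.inner,
        Gx.cell i * Gy.cell j * (q (2 * i + 1) (2 * j + 1) - c) ^ 2
      ≤ 200 * Lx ^ 2 * weightedX Gx Gy q + 200 * Ly ^ 2 * weightedY Gx Gy q := by
  have X0 := weightedX_nonneg Gx Gy q
  have Y0 := weightedY_nonneg Gx Gy q
  have Lx0 := Gx.length_pos
  have Ly0 := Gy.length_pos
  have hx := Gx.sum_inner_le
  have hy := Gy.sum_inner_le
  have hx0 : 0 ≤ ∑ i ∈ Gx.inner, Gx.cell i :=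
    Finset.sum_nonneg fun i hi => (Grid1D.cell_pos_of_mem_inner hi).le
  have hy0 : 0 ≤ ∑ i ∈ Gy.inner, Gy.cell i :=
    Finset.sum_nonneg fun i hi => (Grid1D.cell_pos_of_mem_inner hi).le
  have hX : ∑ j ∈ Gy.inner, Gy.cell j * rowX Gx Gy q (2 * j + 1) ≤ weightedX Gx Gy q := by
    rw [weightedX_eq]
    exact Gy.sum_inner_mul_le _ fun j => rowX_nonneg Gx Gy q _
  have hY : ∑ i ∈ Gx.inner, Gx.cell i * rowX Gy Gx q.swap (2 * i + 1) ≤ weightedY Gx Gy q := by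
    rw [← weightedX_swap, weightedX_eq]
    exact Gx.sum_inner_mul_le _ fun j => rowX_nonneg Gy Gx q.swap _
  suffices key : _ from by
    obtain ⟨c, hc⟩ := exists_sum_mul_sub_sq_le (Gx.inner ×ˢ Gy.inner)
      (fun p => Gx.cell p.1 * Gy.cell p.2) (fun p => q (2 * p.1 + 1) (2 * p.2 + 1))
      (M := 200 * Lx ^ 2 * weightedX Gx Gy q + 200 * Ly ^ 2 * weightedY Gx Gy q) (by positivity)
      (fun p hp => by
        obtain ⟨h1, h2⟩ := Finset.mem_product.mp hp
        exact mul_pos (Grid1D.cell_pos_of_mem_inner h1) (Grid1D.cell_pos_of_mem_inner h2)) key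
    exact ⟨c, by simpa only [Finset.sum_product] using hc⟩
  simp only [Finset.sum_product]
  set H := ∑ i ∈ Gx.inner, Gx.cell i with hH
  set K := ∑ j ∈ Gy.inner, Gy.cell j with hK
  have hHK : ∑ i ∈ Gx.inner, ∑ j ∈ Gy.inner, Gx.cell i * Gy.cell j = H * K := by
    rw [hH, hK, Finset.sum_mul_sum]
  -- two cells are joined by a horizontal segment followed by a vertical one
  calc _ ≤ ∑ i' ∈ Gx.inner, ∑ j' ∈ Gy.inner, Gx.cell i' * Gy.cell j' *
        ∑ i ∈ Gx.inner, ∑ j ∈ Gy.inner, Gx.cell i * Gy.cell j *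
          (200 * Lx * rowX Gx Gy q (2 * j + 1) + 200 * Ly * rowX Gy Gx q.swap (2 * i' + 1)) := by
        refine Finset.sum_le_sum fun i' hi' => Finset.sum_le_sum fun j' hj' => ?_
        refine mul_le_mul_of_nonneg_left ?_ (mul_pos (Grid1D.cell_pos_of_mem_inner hi')
          (Grid1D.cell_pos_of_mem_inner hj')).le
        refine Finset.sum_le_sum fun i hi => Finset.sum_le_sum fun j hj => ?_
        refine mul_le_mul_of_nonneg_left ?_ (mul_pos (Grid1D.cell_pos_of_mem_inner hi)
          (Grid1D.cell_pos_of_mem_inner hj)).le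
        have h1 := sq_sub_le_rowX Gx Gy q hi hi' hj
        have h2 := sq_sub_le_rowX Gy Gx q.swap hj hj' hi'
        simp only [GridFun.swap] at h2 ⊢
        nlinarith [sq_nonneg ((q (2 * i + 1) (2 * j + 1) - q (2 * i' + 1) (2 * j + 1))
          - (q (2 * i' + 1) (2 * j + 1) - q (2 * i' + 1) (2 * j' + 1)))]
    _ = H * K * (200 * Lx * H * ∑ j ∈ Gy.inner, Gy.cell j * rowX Gx Gy q (2 * j + 1)
          + 200 * Ly * K * ∑ i ∈ Gx.inner, Gx.cell i * rowX Gy Gx q.swap (2 * i + 1)) := by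
        have e1 (i' : ℕ) : ∑ i ∈ Gx.inner, ∑ j ∈ Gy.inner, Gx.cell i * Gy.cell j *
          (200 * Lx * rowX Gx Gy q (2 * j + 1) + 200 * Ly * rowX Gy Gx q.swap (2 * i' + 1))
          = 200 * Lx * H * ∑ j ∈ Gy.inner, Gy.cell j * rowX Gx Gy q (2 * j + 1)
            + H * K * (200 * Ly * rowX Gy Gx q.swap (2 * i' + 1)) := by
          simp only [mul_add, Finset.sum_add_distrib]
          congr 1
          · rw [mul_assoc, hH, Finset.sum_mul_sum, Finset.mul_sum]
            refine Finset.sum_congr rfl fun i _ => ?_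
            rw [Finset.mul_sum]
            exact Finset.sum_congr rfl fun j _ => by ring
          · rw [← hHK]
            simp only [Finset.sum_mul]
        simp only [e1]
        simp only [mul_add, Finset.sum_add_distrib]
        congr 1
        · rw [← hHK]
          simp only [Finset.sum_mul]
        · have e2 : ∑ i' ∈ Gx.inner, ∑ j' ∈ Gy.inner, Gx.cell i' * Gy.cell j' *
            (H * K * (200 * Ly * rowX Gy Gx q.swap (2 * i' + 1)))
            = H * K * (200 * Ly) * (∑ i ∈ Gx.inner, ∑ j ∈ Gy.inner,
              (Gx.cell i * rowX Gy Gx q.swap (2 * i + 1)) * Gy.cell j) := by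
            simp only [Finset.mul_sum]
            exact Finset.sum_congr rfl fun i _ => Finset.sum_congr rfl fun j _ => by ring
          rw [e2, ← Finset.sum_mul_sum, ← hK]
          ring
    _ ≤ H * K * (200 * Lx ^ 2 * weightedX Gx Gy q + 200 * Ly ^ 2 * weightedY Gx Gy q) := by
        refine mul_le_mul_of_nonneg_left (add_le_add ?_ ?_) (mul_nonneg hx0 hy0)
        · refine mul_le_mul ?_ hX (Finset.sum_nonneg fun j hj => mul_nonneg
            (Grid1D.cell_pos_of_mem_inner hj).le (rowX_nonneg Gx Gy q _)) (by positivity)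
          nlinarith
        · refine mul_le_mul ?_ hY (Finset.sum_nonneg fun j hj => mul_nonneg
            (Grid1D.cell_pos_of_mem_inner hj).le (rowX_nonneg Gy Gx q.swap _)) (by positivity)
          nlinarith
    _ = _ := by rw [← hHK]

theorem sum_fluxY_mul_sq_le {c ε : ℝ} (hc : 0 ≤ c) (hε : 0 < ε)
    (hreg : ∀ i ∈ Finset.Ico 1 Gy.num,
      Gy.dual i ≤ c * Gy.cell i ∧ Gy.dual i ≤ c * Gy.cell (i - 1)) (s : GridFun) :
    ∑ i ∈ Finset.range Gx.num, ∑ j ∈ Finset.range Gy.num,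
        fluxX Gy Gx j i * s (2 * i + 1) (2 * j + 1) ^ 2
      ≤ Ly ^ 2 / (8 * ε) * weightedY Gx Gy s + 2 * c * ε * innerM Gx Gy s s := by
  have h := sum_fluxX_mul_sq_le Gy Gx hc hε hreg s.swap
  rw [weightedX_swap, innerM_swap, Finset.sum_comm] at h
  exact h

theorem gradX_sub_const (q : GridFun) (c : ℝ) :
    gradX Gx (fun a b => q a b - c) = gradX Gx q := by
  funext a b
  simp [gradX, Dx]

theorem gradY_sub_const (q : GridFun) (c : ℝ) :
    gradY Gy (fun a b => q a b - c) = gradY Gy q := by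
  funext a b
  simp [gradY, Dy]

end Operators

/-- The Poincaré inequality for cell functions of mean zero, with a gradient that is weighted with
the distance to the boundary. Near the boundary it is the Hardy inequality that the inward field
gives, in the interior it is the usual Poincaré inequality. -/
theorem exists_innerM_le_weighted {Lx Ly C₀ : ℝ} (hLx : 0 < Lx) (hLy : 0 < Ly) (hC₀ : 0 < C₀) :
    ∃ K > 0, ∀ (Gx : Grid1D Lx) (Gy : Grid1D Ly), IsRegular Gx Gy C₀ → ∀ q : GridFun,
      innerM Gx Gy q (fun _ _ => 1) = 0 →
        innerM Gx Gy q q ≤ K * (weightedX Gx Gy q + weightedY Gx Gy q) := by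
  refine ⟨(3600 + 32 / C₀) * (Lx ^ 2 + Ly ^ 2), by positivity, ?_⟩
  intro Gx Gy hreg q hq
  obtain ⟨c, hc⟩ := exists_sum_inner_sub_sq_le Gx Gy q
  have X0 := weightedX_nonneg Gx Gy q
  have Y0 := weightedY_nonneg Gx Gy q
  set s : GridFun := fun a b => q a b - c with hs
  have hX : weightedX Gx Gy s = weightedX Gx Gy q := by
    unfold weightedX; rw [hs, gradX_sub_const]
  have hY : weightedY Gx Gy s = weightedY Gx Gy q := by
    unfold weightedY; rw [hs, gradY_sub_const]
  have hqs : innerM Gx Gy q q ≤ innerM Gx Gy s s := by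
    have e : innerM Gx Gy s s = innerM Gx Gy q q - 2 * c * innerM Gx Gy q (fun _ _ => 1)
        + innerM Gx Gy (fun _ _ => c) (fun _ _ => c) := by
      unfold innerM
      simp only [Finset.mul_sum, ← Finset.sum_sub_distrib, ← Finset.sum_add_distrib]
      exact Finset.sum_congr rfl fun i _ => Finset.sum_congr rfl fun j _ => by rw [hs]; ring
    have h0 : 0 ≤ innerM Gx Gy (fun _ _ => c) (fun _ _ => c) :=
      Finset.sum_nonneg fun i hi => Finset.sum_nonneg fun j hj => by
        have h1 := Gx.cell_pos (Finset.mem_range.mp hi)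
        have h2 := Gy.cell_pos (Finset.mem_range.mp hj)
        nlinarith [mul_nonneg (mul_pos h1 h2).le (mul_self_nonneg c)]
    rw [e, hq]
    linarith
  -- this `ε` lets the left-hand side absorb half of the zeroth-order terms
  have hε : 0 < C₀ / 32 := by positivity
  have h1 := sum_fluxX_mul_sq_le Gx Gy (one_div_pos.mpr hC₀).le hε (hreg.dual_le_x hC₀) s
  have h2 := sum_fluxY_mul_sq_le Gx Gy (one_div_pos.mpr hC₀).le hε (hreg.swap.dual_le_x hC₀) s
  have h3 : 1 / 4 * innerM Gx Gy s s - 9 / 4 * ∑ i ∈ Gx.inner, ∑ j ∈ Gy.inner,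
        Gx.cell i * Gy.cell j * (q (2 * i + 1) (2 * j + 1) - c) ^ 2
      ≤ ∑ i ∈ Finset.range Gx.num, ∑ j ∈ Finset.range Gy.num,
        (fluxX Gx Gy i j * s (2 * i + 1) (2 * j + 1) ^ 2
          + fluxX Gy Gx j i * s (2 * i + 1) (2 * j + 1) ^ 2) := by
    have e : 1 / 4 * innerM Gx Gy s s - 9 / 4 * ∑ i ∈ Gx.inner, ∑ j ∈ Gy.inner,
        Gx.cell i * Gy.cell j * (q (2 * i + 1) (2 * j + 1) - c) ^ 2
      = ∑ i ∈ Finset.range Gx.num, ∑ j ∈ Finset.range Gy.num,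
        Gx.cell i * Gy.cell j * (1 / 4 -
          (if |Gx.ref (2 * i + 1)| < 9 / 10 ∧ |Gy.ref (2 * j + 1)| < 9 / 10 then 9 / 4 else 0))
          * s (2 * i + 1) (2 * j + 1) ^ 2 := by
      unfold innerM Grid1D.inner
      simp only [Finset.sum_filter, Finset.mul_sum, ← Finset.sum_sub_distrib]
      refine Finset.sum_congr rfl fun i _ => ?_
      by_cases hi : |Gx.ref (2 * i + 1)| < 9 / 10
      · simp only [hi, if_true, true_and, Finset.mul_sum, ← Finset.sum_sub_distrib]
        refine Finset.sum_congr rfl fun j _ => ?_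
        split_ifs <;> simp only [hs] <;> ring
      · simp only [hi, if_false, false_and, mul_zero, sub_zero]
        refine Finset.sum_congr rfl fun j _ => ?_
        ring
    rw [e]
    refine Finset.sum_le_sum fun i hi => Finset.sum_le_sum fun j hj => ?_
    rw [← add_mul]
    exact mul_le_mul_of_nonneg_right
      (flux_ge Gx Gy (Finset.mem_range.mp hi) (Finset.mem_range.mp hj)) (sq_nonneg _)
  simp only [Finset.sum_add_distrib] at h3
  rw [hX] at h1
  rw [hY] at h2
  have e1 : 2 * (1 / C₀) * (C₀ / 32) = 1 / 16 := by field_simp; norm_num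
  have e2 : ∀ L : ℝ, L ^ 2 / (8 * (C₀ / 32)) = 4 / C₀ * L ^ 2 := fun L => by field_simp; ring
  rw [e1, e2] at h1 h2
  have h4 : 0 ≤ (3600 + 32 / C₀) * (Lx ^ 2 * weightedY Gx Gy q + Ly ^ 2 * weightedX Gx Gy q) := by
    positivity
  have e3 : 32 / C₀ = 8 * (4 / C₀) := by ring
  rw [e3] at h4 ⊢
  generalize 4 / C₀ = t at *
  nlinarith

/-! ### Gradients, divergence-free fields and curls -/

section Operators

variable {Lx Ly : ℝ} (Gx : Grid1D Lx) (Gy : Grid1D Ly)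

theorem innerTM_gradX (q v : GridFun) (h0 : ∀ j < Gy.num, v 0 (2 * j + 1) = 0)
    (h1 : ∀ j < Gy.num, v (2 * Gx.num) (2 * j + 1) = 0) :
    innerTM Gx Gy (gradX Gx q) v = -innerM Gx Gy q (fun a b => dx Gx v (a / 2) b) := by
  unfold innerTM innerM
  rw [Finset.sum_comm, Finset.sum_comm (s := Finset.range Gx.num), ← Finset.sum_neg_distrib]
  refine Finset.sum_congr rfl fun j hj => ?_
  have hj := Finset.mem_range.mp hj
  have parts := sum_Ico_sub_mul_eq Gx.num_pos (fun i => q (2 * i + 1) (2 * j + 1))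
    (fun i => Gy.cell j * v (2 * i) (2 * j + 1)) (by simp [h0 j hj]) (by simp [h1 j hj])
  refine Eq.trans ?_ (parts.trans ?_)
  · refine Finset.sum_congr rfl fun i hi => ?_
    have hd := (Gx.dual_pos hi).ne'
    rw [gradX_apply _ _ hi,
      show 2 * i - 1 = 2 * (i - 1) + 1 by have := (Finset.mem_Ico.mp hi).1; omega]
    field_simp
  · congr 1
    refine Finset.sum_congr rfl fun i hi => ?_
    have hd := (Gx.cell_pos (Finset.mem_range.mp hi)).ne'
    simp only [dx, show (2 * i + 1) / 2 = i by omega, show 2 * (i + 1) = 2 * i + 2 by ring]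
    field_simp

/-- Discrete gradients are orthogonal to discrete velocities that are divergence-free and have no
flux through the boundary. -/
theorem inner_grad_eq_zero (q vx vy : GridFun)
    (hx0 : ∀ j < Gy.num, vx 0 (2 * j + 1) = 0)
    (hx1 : ∀ j < Gy.num, vx (2 * Gx.num) (2 * j + 1) = 0)
    (hy0 : ∀ i < Gx.num, vy (2 * i + 1) 0 = 0)
    (hy1 : ∀ i < Gx.num, vy (2 * i + 1) (2 * Gy.num) = 0)
    (hdiv : ∀ i < Gx.num, ∀ j < Gy.num,
      dx Gx vx i (2 * j + 1) + dy Gy vy (2 * i + 1) j = 0) :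
    innerTM Gx Gy (gradX Gx q) vx + innerMT Gx Gy (gradY Gy q) vy = 0 := by
  rw [← innerTM_swap, ← gradX_swap, innerTM_gradX Gx Gy q vx hx0 hx1,
    innerTM_gradX Gy Gx q.swap vy.swap hy0 hy1]
  have e : innerM Gy Gx q.swap (fun a b => dx Gy vy.swap (a / 2) b)
      = innerM Gx Gy q (fun a b => dy Gy vy a (b / 2)) := by
    rw [← innerM_swap Gx Gy]
    rfl
  rw [e, ← neg_add, neg_eq_zero]
  unfold innerM
  rw [← Finset.sum_add_distrib]
  refine Finset.sum_eq_zero fun i hi => ?_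
  rw [← Finset.sum_add_distrib]
  refine Finset.sum_eq_zero fun j hj => ?_
  have h := hdiv i (Finset.mem_range.mp hi) j (Finset.mem_range.mp hj)
  simp only [show (2 * i + 1) / 2 = i by omega, show (2 * j + 1) / 2 = j by omega]
  rw [← mul_add, h, mul_zero]

/-- The first component of the curl of a function `r` on the grid points `(x_i, y_j)`. -/
noncomputable def rotX (r : GridFun) : GridFun := fun a b => dy Gy r a (b / 2)

/-- The second component of the curl of a function `r` on the grid points `(x_i, y_j)`. -/
noncomputable def rotY (r : GridFun) : GridFun := fun a b => -dx Gx r (a / 2) b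

theorem inner_grad_rot_eq_zero (q s : GridFun)
    (hx0 : ∀ j ≤ Gy.num, s 0 (2 * j) = 0) (hx1 : ∀ j ≤ Gy.num, s (2 * Gx.num) (2 * j) = 0)
    (hy0 : ∀ i ≤ Gx.num, s (2 * i) 0 = 0) (hy1 : ∀ i ≤ Gx.num, s (2 * i) (2 * Gy.num) = 0) :
    innerTM Gx Gy (gradX Gx q) (rotX Gy s) + innerMT Gx Gy (gradY Gy q) (rotY Gx s) = 0 := by
  have half (l : ℕ) : (2 * l + 1) / 2 = l := by omega
  refine inner_grad_eq_zero Gx Gy q _ _ (fun j hj => ?_) (fun j hj => ?_) (fun i hi => ?_)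
    (fun i hi => ?_) fun i hi j hj => ?_
  · have h1 := hx0 j (by omega)
    have h2 := hx0 (j + 1) (by omega)
    rw [show 2 * (j + 1) = 2 * j + 2 by ring] at h2
    simp [rotX, dy, half, h1, h2]
  · have h1 := hx1 j (by omega)
    have h2 := hx1 (j + 1) (by omega)
    rw [show 2 * (j + 1) = 2 * j + 2 by ring] at h2
    simp [rotX, dy, half, h1, h2]
  · have h1 := hy0 i (by omega)
    have h2 := hy0 (i + 1) (by omega)
    rw [show 2 * (i + 1) = 2 * i + 2 by ring] at h2
    simp [rotY, dx, half, h1, h2]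
  · have h1 := hy1 i (by omega)
    have h2 := hy1 (i + 1) (by omega)
    rw [show 2 * (i + 1) = 2 * i + 2 by ring] at h2
    simp [rotY, dx, half, h1, h2]
  · have h1 := (Gx.cell_pos hi).ne'
    have h2 := (Gy.cell_pos hj).ne'
    simp only [rotX, rotY, dx, dy, half]
    field_simp
    ring

/-! ### A Caccioppoli inequality for the discrete pressure -/

theorem cutoff_nonneg {a b : ℕ} (ha : a ≤ 2 * Gx.num) (hb : b ≤ 2 * Gy.num) :
    0 ≤ cutoff Gx Gy a b := by
  have := max_le (Gx.abs_ref_le ha) (Gy.abs_ref_le hb)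
  unfold cutoff
  linarith

theorem cutoff_le_one (a b : ℕ) : cutoff Gx Gy a b ≤ 1 := by
  have := (abs_nonneg (Gx.ref a)).trans (le_max_left _ |Gy.ref b|)
  unfold cutoff
  linarith

theorem cutoff_sub_le (a b b' : ℕ) :
    cutoff Gx Gy a b ≤ cutoff Gx Gy a b' + |Gy.ref b' - Gy.ref b| := by
  have h1 : |Gy.ref b'| ≤ |Gy.ref b| + |Gy.ref b' - Gy.ref b| := by
    have := abs_add_le (Gy.ref b) (Gy.ref b' - Gy.ref b)
    rwa [add_sub_cancel] at this
  have h2 : max |Gx.ref a| |Gy.ref b'| ≤ max |Gx.ref a| |Gy.ref b| + |Gy.ref b' - Gy.ref b| := by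
    refine max_le ?_ ?_
    · linarith [le_max_left |Gx.ref a| |Gy.ref b|, abs_nonneg (Gy.ref b' - Gy.ref b)]
    · linarith [le_max_right |Gx.ref a| |Gy.ref b|]
  unfold cutoff
  linarith

/-- The Caccioppoli estimate on a single edge with end points `a`, `b` and length `k`: here `χ`
denotes the cutoff (at the end points and at the midpoint `m`), `r` the stream function, and the
gradient is the sum of the force `F` and the slope of `r`. -/
theorem edge_estimate {k l F ra rb χa χb χm : ℝ} (hk : 0 < k) (ha0 : 0 ≤ χa)
    (ha1 : χa ≤ 1) (hb0 : 0 ≤ χb) (hb1 : χb ≤ 1) (hm0 : 0 ≤ χm) (hm1 : χm ≤ 1)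
    (hab : |χb - χa| ≤ l * k) (hma : χm ≤ χa + l * k / 2) (hmb : χm ≤ χb + l * k / 2) :
    (χm * (F + (rb - ra) / k)) ^ 2
      ≤ 16 / 3 * ((F + (rb - ra) / k) * ((χb ^ 2 * rb - χa ^ 2 * ra) / k)) + 16 * F ^ 2
        + 30 * l ^ 2 * (ra ^ 2 + rb ^ 2) := by
  obtain ⟨g, hg⟩ : ∃ g, g = (rb - ra) / k := ⟨_, rfl⟩
  obtain ⟨d, hd⟩ : ∃ d, d = (χb - χa) / k := ⟨_, rfl⟩
  obtain ⟨w, hw⟩ : ∃ w, w = (χa ^ 2 + χb ^ 2) / 2 := ⟨_, rfl⟩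
  obtain ⟨ρ, hρ⟩ : ∃ ρ, ρ = ra ^ 2 + rb ^ 2 := ⟨_, rfl⟩
  obtain ⟨θ, hθ⟩ : ∃ θ, θ = d * (χa + χb) * ((ra + rb) / 2) := ⟨_, rfl⟩
  have hs : (χb ^ 2 * rb - χa ^ 2 * ra) / k = w * g + θ := by
    rw [hθ, hw, hg, hd]; field_simp; ring
  have hkg : k * g = rb - ra := by rw [hg]; field_simp
  rw [hs, ← hg, ← hρ]
  have hw0 : 0 ≤ w := by rw [hw]; positivity
  have hw1 : w ≤ 1 := by rw [hw]; nlinarith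
  have hρ0 : 0 ≤ ρ := by rw [hρ]; positivity
  have hl2 : 0 ≤ l ^ 2 := sq_nonneg l
  have hd2 : d ^ 2 ≤ l ^ 2 := by
    have : |d| ≤ l := by rw [hd, abs_div, abs_of_pos hk, div_le_iff₀ hk]; exact hab
    rw [← sq_abs d]
    exact pow_le_pow_left₀ (abs_nonneg d) this 2
  have hθ2 : θ ^ 2 ≤ w * (2 * l ^ 2 * ρ) := by
    have h1 : (χa + χb) ^ 2 ≤ 4 * w := by rw [hw]; nlinarith [sq_nonneg (χa - χb)]
    have h2 : ((ra + rb) / 2) ^ 2 ≤ ρ / 2 := by rw [hρ]; nlinarith [sq_nonneg (ra - rb)]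
    have h3 := mul_le_mul hd2 h1 (sq_nonneg _) hl2
    have h4 := mul_le_mul h3 h2 (sq_nonneg _) (by positivity)
    calc θ ^ 2 = d ^ 2 * (χa + χb) ^ 2 * ((ra + rb) / 2) ^ 2 := by rw [hθ]; ring
      _ ≤ _ := h4
      _ = _ := by ring
  have hQ : 0 ≤ 2 * l ^ 2 * ρ := by positivity
  have hgθ : |g * θ| ≤ w * g ^ 2 / 8 + 2 * (2 * l ^ 2 * ρ) := by
    refine abs_le_of_sq_le_sq ?_ (by positivity)
    have h1 := mul_le_mul_of_nonneg_left hθ2 (sq_nonneg g)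
    have h2 := sq_nonneg (w * g ^ 2 / 8 - 2 * (2 * l ^ 2 * ρ))
    linarith
  have hgθ' := neg_le_of_abs_le hgθ
  have hFg : -(w * g ^ 2 / 8) - 2 * F ^ 2 ≤ w * (F * g) := by
    have h1 := mul_nonneg hw0 (sq_nonneg (g + 4 * F))
    have h2 := mul_le_mul_of_nonneg_right hw1 (sq_nonneg F)
    linarith
  have hFθ : -(F ^ 2 / 2) - 2 * l ^ 2 * ρ / 2 ≤ F * θ := by
    have h1 := sq_nonneg (F + θ)
    have h2 := mul_le_mul_of_nonneg_right hw1 hQ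
    linarith
  have hm : χm ^ 2 ≤ 2 * w + l ^ 2 * k ^ 2 / 2 := by
    have h1 : χm ^ 2 ≤ (χa + l * k / 2) ^ 2 := pow_le_pow_left₀ hm0 hma 2
    have h2 : χm ^ 2 ≤ (χb + l * k / 2) ^ 2 := pow_le_pow_left₀ hm0 hmb 2
    have h3 := sq_nonneg (χa - l * k / 2)
    have h4 := sq_nonneg (χb - l * k / 2)
    rw [hw]
    linarith
  have hmg : χm ^ 2 * g ^ 2 ≤ 2 * (w * g ^ 2) + l ^ 2 * ρ := by
    have h1 := mul_le_mul_of_nonneg_right hm (sq_nonneg g)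
    have h2 : (k * g) ^ 2 ≤ 2 * ρ := by rw [hkg, hρ]; nlinarith [sq_nonneg (ra + rb)]
    have h3 := mul_le_mul_of_nonneg_left h2 hl2
    linarith
  have hmF : (χm * (F + g)) ^ 2 ≤ 2 * (χm ^ 2 * F ^ 2) + 2 * (χm ^ 2 * g ^ 2) := by
    have h1 := mul_nonneg (sq_nonneg χm) (sq_nonneg (F - g))
    linarith
  have hm2 : χm ^ 2 * F ^ 2 ≤ F ^ 2 :=
    mul_le_of_le_one_left (sq_nonneg F) (pow_le_one₀ hm0 hm1)
  have hlρ : 0 ≤ l ^ 2 * ρ := mul_nonneg hl2 hρ0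
  have hF := sq_nonneg F
  linarith

/-- The square of the norm of a function on the grid points that lie in the interior of the
interval in the `x` direction. -/
noncomputable def nodeNormX (r : GridFun) : ℝ :=
  ∑ i ∈ Finset.Ico 1 Gx.num, ∑ j ∈ Finset.range (Gy.num + 1),
    Gx.dual i * Gy.dual j * r (2 * i) (2 * j) ^ 2

theorem weightedX_le (q F r : GridFun)
    (h : ∀ i ∈ Finset.Ico 1 Gx.num, ∀ j < Gy.num,
      gradX Gx q (2 * i) (2 * j + 1) = F (2 * i) (2 * j + 1) + rotX Gy r (2 * i) (2 * j + 1)) :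
    weightedX Gx Gy q
      ≤ 16 / 3 * innerTM Gx Gy (gradX Gx q) (rotX Gy fun a b => cutoff Gx Gy a b ^ 2 * r a b)
        + 16 * innerTM Gx Gy F F + 240 / Ly ^ 2 * nodeNormX Gx Gy r := by
  have Ly0 := Gy.length_pos
  have half (l : ℕ) : (2 * l + 1) / 2 = l := by omega
  have e1 : 240 / Ly ^ 2 * nodeNormX Gx Gy r
      = ∑ i ∈ Finset.Ico 1 Gx.num, ∑ j ∈ Finset.range Gy.num, Gx.dual i * Gy.cell j
        * (30 * (2 / Ly) ^ 2 * (r (2 * i) (2 * j) ^ 2 + r (2 * i) (2 * j + 2) ^ 2)) := by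
    unfold nodeNormX
    rw [Finset.mul_sum]
    refine Finset.sum_congr rfl fun i _ => ?_
    have h2 := Gy.sum_cell_mul_add fun j => r (2 * i) (2 * j) ^ 2
    have h3 : ∑ j ∈ Finset.range (Gy.num + 1), Gx.dual i * Gy.dual j * r (2 * i) (2 * j) ^ 2
        = Gx.dual i * ∑ j ∈ Finset.range (Gy.num + 1), Gy.dual j * r (2 * i) (2 * j) ^ 2 := by
      rw [Finset.mul_sum]
      exact Finset.sum_congr rfl fun j _ => by ring
    have h4 : ∑ j ∈ Finset.range Gy.num, Gx.dual i * Gy.cell j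
        * (30 * (2 / Ly) ^ 2 * (r (2 * i) (2 * j) ^ 2 + r (2 * i) (2 * j + 2) ^ 2))
        = Gx.dual i * (30 * (2 / Ly) ^ 2) * ∑ j ∈ Finset.range Gy.num,
          Gy.cell j * (r (2 * i) (2 * j) ^ 2 + r (2 * i) (2 * (j + 1)) ^ 2) := by
      rw [Finset.mul_sum]
      exact Finset.sum_congr rfl fun j _ => by rw [show 2 * (j + 1) = 2 * j + 2 by ring]; ring
    rw [h3, h4, h2]
    ring
  rw [e1]
  unfold weightedX innerTM
  simp only [Finset.mul_sum, ← Finset.sum_add_distrib]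
  refine Finset.sum_le_sum fun i hi => Finset.sum_le_sum fun j hj => ?_
  obtain ⟨hi1, hi2⟩ := Finset.mem_Ico.mp hi
  have hj := Finset.mem_range.mp hj
  have hc := Gy.cell_pos hj
  have ec := Gy.cell_eq j
  have eo := Gy.ref_odd j
  have hr : Gy.ref (2 * j + 2) - Gy.ref (2 * j) = 2 / Ly * Gy.cell j := by
    rw [ec]; field_simp
  have hr0 : 0 ≤ 2 / Ly * Gy.cell j := by positivity
  rw [h i hi j hj]
  simp only [rotX, dy, half]
  have key := edge_estimate (k := Gy.cell j) (l := 2 / Ly) (F := F (2 * i) (2 * j + 1))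
    (ra := r (2 * i) (2 * j)) (rb := r (2 * i) (2 * j + 2)) hc
    (cutoff_nonneg Gx Gy (a := 2 * i) (b := 2 * j) (by omega) (by omega))
    (cutoff_le_one Gx Gy _ _)
    (cutoff_nonneg Gx Gy (a := 2 * i) (b := 2 * j + 2) (by omega) (by omega))
    (cutoff_le_one Gx Gy _ _)
    (cutoff_nonneg Gx Gy (a := 2 * i) (b := 2 * j + 1) (by omega) (by omega))
    (cutoff_le_one Gx Gy _ _) ?_ ?_ ?_
  · have h0 := mul_pos (Gx.dual_pos hi) hc
    have := mul_le_mul_of_nonneg_left key h0.le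
    linarith
  · have h1 := cutoff_sub_le Gx Gy (2 * i) (2 * j) (2 * j + 2)
    have h2 := cutoff_sub_le Gx Gy (2 * i) (2 * j + 2) (2 * j)
    rw [abs_sub_comm, hr, abs_of_nonneg hr0] at h2
    rw [hr, abs_of_nonneg hr0] at h1
    exact abs_le.mpr ⟨by linarith, by linarith⟩
  · have h1 := cutoff_sub_le Gx Gy (2 * i) (2 * j + 1) (2 * j)
    rwa [show Gy.ref (2 * j) - Gy.ref (2 * j + 1) = -(2 / Ly * Gy.cell j / 2) by rw [eo]; linarith,
      abs_neg, abs_of_nonneg (by positivity)] at h1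
  · have h1 := cutoff_sub_le Gx Gy (2 * i) (2 * j + 1) (2 * j + 2)
    rwa [show Gy.ref (2 * j + 2) - Gy.ref (2 * j + 1) = 2 / Ly * Gy.cell j / 2 by rw [eo]; linarith,
      abs_of_nonneg (by positivity)] at h1

theorem weightedY_le (q F r : GridFun)
    (h : ∀ i < Gx.num, ∀ j ∈ Finset.Ico 1 Gy.num,
      gradY Gy q (2 * i + 1) (2 * j) = F (2 * i + 1) (2 * j) + rotY Gx r (2 * i + 1) (2 * j)) :
    weightedY Gx Gy q
      ≤ 16 / 3 * innerMT Gx Gy (gradY Gy q) (rotY Gx fun a b => cutoff Gx Gy a b ^ 2 * r a b)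
        + 16 * innerMT Gx Gy F F + 240 / Lx ^ 2 * nodeNormX Gy Gx r.swap := by
  -- exchanging the coordinates reverses the orientation, hence the sign of the stream function
  have rot (s : GridFun) : rotX Gx (fun a b => -s b a) = (rotY Gx s).swap := by
    funext a b
    simp only [rotX, rotY, dy, dx, GridFun.swap]
    ring
  have key := weightedX_le Gy Gx q.swap F.swap (fun a b => -r b a) fun j hj i hi => by
    rw [rot]
    exact h i hi j hj
  have e1 : (fun a b => cutoff Gy Gx a b ^ 2 * -r b a)
      = fun a b => -(fun a b => cutoff Gx Gy a b ^ 2 * r a b) b a := by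
    funext a b
    rw [cutoff_swap, GridFun.swap]
    ring
  have e2 : nodeNormX Gy Gx (fun a b => -r b a) = nodeNormX Gy Gx r.swap := by
    simp only [nodeNormX, neg_sq, GridFun.swap]
  rwa [e1, rot, e2, weightedX_swap, innerTM_swap, gradX_swap, innerTM_swap] at key

/-- If the gradient of `q` is, up to a force `F`, the curl of `r`, then the weighted norm of the
gradient is bounded by the norms of `F` and `r`: no derivative of `r` is needed, because the curl
of the localized stream function is orthogonal to gradients. -/
theorem weighted_le (q Fx Fy r : GridFun)
    (hx : ∀ i ∈ Finset.Ico 1 Gx.num, ∀ j < Gy.num,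
      gradX Gx q (2 * i) (2 * j + 1) = Fx (2 * i) (2 * j + 1) + rotX Gy r (2 * i) (2 * j + 1))
    (hy : ∀ i < Gx.num, ∀ j ∈ Finset.Ico 1 Gy.num,
      gradY Gy q (2 * i + 1) (2 * j) = Fy (2 * i + 1) (2 * j) + rotY Gx r (2 * i + 1) (2 * j)) :
    weightedX Gx Gy q + weightedY Gx Gy q
      ≤ 16 * (innerTM Gx Gy Fx Fx + innerMT Gx Gy Fy Fy)
        + (240 / Ly ^ 2 * nodeNormX Gx Gy r + 240 / Lx ^ 2 * nodeNormX Gy Gx r.swap) := by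
  have h1 := weightedX_le Gx Gy q Fx r hx
  have h2 := weightedY_le Gx Gy q Fy r hy
  have cut (a b : ℕ) (h : max |Gx.ref a| |Gy.ref b| = 1) : cutoff Gx Gy a b ^ 2 * r a b = 0 := by
    rw [cutoff, h]
    ring
  have h3 := inner_grad_rot_eq_zero Gx Gy q (fun a b => cutoff Gx Gy a b ^ 2 * r a b)
    (fun j hj => cut _ _ ?_) (fun j hj => cut _ _ ?_) (fun i hi => cut _ _ ?_)
    (fun i hi => cut _ _ ?_)
  · linarith
  · rw [Gx.ref_zero, abs_neg, abs_one, max_eq_left (Gy.abs_ref_le (by omega))]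
  · rw [Gx.ref_last, abs_one, max_eq_left (Gy.abs_ref_le (by omega))]
  · rw [Gy.ref_zero, abs_neg, abs_one, max_eq_right (Gx.abs_ref_le (by omega))]
  · rw [Gy.ref_last, abs_one, max_eq_right (Gx.abs_ref_le (by omega))]

end Operators

/-! ### The weak form of the scheme -/

section Operators

variable {Lx Ly : ℝ} (Gx : Grid1D Lx) (Gy : Grid1D Ly)

/-- The inner product of the velocity space. -/
noncomputable def velForm : LinearMap.BilinForm ℝ (GridFun × GridFun) :=
  LinearMap.mk₂ ℝ (fun u v => innerTM Gx Gy u.1 v.1 + innerMT Gx Gy u.2 v.2)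
    (fun u u' v => by
      simp only [innerTM, innerMT, Prod.fst_add, Prod.snd_add, Pi.add_apply, mul_add, add_mul,
        Finset.sum_add_distrib]
      ring)
    (fun c u v => by
      simp only [innerTM, innerMT, Prod.smul_fst, Prod.smul_snd, Pi.smul_apply, smul_eq_mul,
        mul_add, Finset.mul_sum]
      congr 1 <;> exact Finset.sum_congr rfl fun _ _ => Finset.sum_congr rfl fun _ _ => by ring)
    (fun u v v' => by
      simp only [innerTM, innerMT, Prod.fst_add, Prod.snd_add, Pi.add_apply, mul_add,
        Finset.sum_add_distrib]
      ring)
    (fun c u v => by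
      simp only [innerTM, innerMT, Prod.smul_fst, Prod.smul_snd, Pi.smul_apply, smul_eq_mul,
        mul_add, Finset.mul_sum]
      congr 1 <;> exact Finset.sum_congr rfl fun _ _ => Finset.sum_congr rfl fun _ _ => by ring)

theorem velForm_apply (u v : GridFun × GridFun) :
    velForm Gx Gy u v = innerTM Gx Gy u.1 v.1 + innerMT Gx Gy u.2 v.2 := rfl

/-- The Dirichlet form of the first velocity component, as a form on discrete functions on the
points `(x_i, y_{j+1/2})`. -/
noncomputable def dirichletX (u v : GridFun) : ℝ :=
  ∑ i ∈ Finset.range Gx.num, ∑ j ∈ Finset.range Gy.num,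
      Gx.cell i * Gy.cell j * (dx Gx u i (2 * j + 1) * dx Gx v i (2 * j + 1))
    + ∑ i ∈ Finset.Ico 1 Gx.num, ∑ j ∈ Finset.range (Gy.num + 1),
      Gx.dual i * Gy.dual j * (Dy Gy u (2 * i) j * Dy Gy v (2 * i) j)

theorem dirichletX_comm (u v : GridFun) : dirichletX Gx Gy u v = dirichletX Gx Gy v u := by
  simp only [dirichletX, mul_comm (dx Gx u _ _), mul_comm (Dy Gy u _ _)]

theorem dirichletX_add (u u' v : GridFun) :
    dirichletX Gx Gy (u + u') v = dirichletX Gx Gy u v + dirichletX Gx Gy u' v := by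
  have h1 (i b : ℕ) : dx Gx (u + u') i b = dx Gx u i b + dx Gx u' i b := by
    simp only [dx, Pi.add_apply]; ring
  have h2 (a j : ℕ) : Dy Gy (u + u') a j = Dy Gy u a j + Dy Gy u' a j := by
    simp only [Dy, Pi.add_apply]; ring
  simp only [dirichletX, h1, h2, add_mul, mul_add, Finset.sum_add_distrib]
  ring

theorem dirichletX_smul (c : ℝ) (u v : GridFun) :
    dirichletX Gx Gy (c • u) v = c * dirichletX Gx Gy u v := by
  have h1 (i b : ℕ) : dx Gx (c • u) i b = c * dx Gx u i b := by
    simp only [dx, Pi.smul_apply, smul_eq_mul]; ring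
  have h2 (a j : ℕ) : Dy Gy (c • u) a j = c * Dy Gy u a j := by
    simp only [Dy, Pi.smul_apply, smul_eq_mul]; ring
  simp only [dirichletX, h1, h2, mul_add, Finset.mul_sum]
  congr 1 <;> exact Finset.sum_congr rfl fun _ _ => Finset.sum_congr rfl fun _ _ => by ring

theorem nodeNormX_nonneg (r : GridFun) : 0 ≤ nodeNormX Gx Gy r :=
  Finset.sum_nonneg fun i hi => Finset.sum_nonneg fun j hj => mul_nonneg
    (mul_nonneg (Gx.dual_pos hi).le (Gy.dual_nonneg j (by simp at hj; omega))) (sq_nonneg _)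

theorem nodeNormX_le_dirichletX (u : GridFun) :
    nodeNormX Gx Gy (fun a b => Dy Gy u a (b / 2)) ≤ dirichletX Gx Gy u u := by
  have h : 0 ≤ ∑ i ∈ Finset.range Gx.num, ∑ j ∈ Finset.range Gy.num,
      Gx.cell i * Gy.cell j * (dx Gx u i (2 * j + 1) * dx Gx u i (2 * j + 1)) :=
    Finset.sum_nonneg fun i hi => Finset.sum_nonneg fun j hj => mul_nonneg
      (mul_pos (Gx.cell_pos (Finset.mem_range.mp hi)) (Gy.cell_pos (Finset.mem_range.mp hj))).le
      (mul_self_nonneg _)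
  have e : nodeNormX Gx Gy (fun a b => Dy Gy u a (b / 2))
      = ∑ i ∈ Finset.Ico 1 Gx.num, ∑ j ∈ Finset.range (Gy.num + 1),
        Gx.dual i * Gy.dual j * (Dy Gy u (2 * i) j * Dy Gy u (2 * i) j) := by
    simp only [nodeNormX, Nat.mul_div_cancel_left _ two_pos, sq]
  rw [e, dirichletX]
  linarith

theorem dirichletX_nonneg (u : GridFun) : 0 ≤ dirichletX Gx Gy u u :=
  (nodeNormX_nonneg Gx Gy _).trans (nodeNormX_le_dirichletX Gx Gy u)

/-- The Dirichlet form of the velocity space. -/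
noncomputable def gradForm : LinearMap.BilinForm ℝ (GridFun × GridFun) :=
  LinearMap.mk₂ ℝ
    (fun u v => dirichletX Gx Gy u.1 v.1 + dirichletX Gy Gx (GridFun.swap u.2) (GridFun.swap v.2))
    (fun u u' v => by
      have h := dirichletX_add Gy Gx (GridFun.swap u.2) (GridFun.swap u'.2) (GridFun.swap v.2)
      have h' := dirichletX_add Gx Gy u.1 u'.1 v.1
      exact (congrArg₂ (· + ·) h' h).trans (by ring))
    (fun c u v => by
      have h := dirichletX_smul Gy Gx c (GridFun.swap u.2) (GridFun.swap v.2)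
      have h' := dirichletX_smul Gx Gy c u.1 v.1
      exact (congrArg₂ (· + ·) h' h).trans (by rw [smul_eq_mul]; ring))
    (fun u v v' => by
      simp only [dirichletX_comm _ _ u.1, dirichletX_comm _ _ (GridFun.swap u.2)]
      have h := dirichletX_add Gy Gx (GridFun.swap v.2) (GridFun.swap v'.2) (GridFun.swap u.2)
      have h' := dirichletX_add Gx Gy v.1 v'.1 u.1
      exact (congrArg₂ (· + ·) h' h).trans (by ring))
    (fun c u v => by
      simp only [dirichletX_comm _ _ u.1, dirichletX_comm _ _ (GridFun.swap u.2)]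
      have h := dirichletX_smul Gy Gx c (GridFun.swap v.2) (GridFun.swap u.2)
      have h' := dirichletX_smul Gx Gy c v.1 u.1
      exact (congrArg₂ (· + ·) h' h).trans (by rw [smul_eq_mul]; ring))

theorem gradForm_apply (u v : GridFun × GridFun) :
    gradForm Gx Gy u v
      = dirichletX Gx Gy u.1 v.1 + dirichletX Gy Gx (GridFun.swap u.2) (GridFun.swap v.2) := rfl

theorem gradForm_comm (u v : GridFun × GridFun) : gradForm Gx Gy u v = gradForm Gx Gy v u := by
  rw [gradForm_apply, gradForm_apply, dirichletX_comm, dirichletX_comm Gy Gx]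

theorem gradForm_nonneg (u : GridFun × GridFun) : 0 ≤ gradForm Gx Gy u u :=
  add_nonneg (dirichletX_nonneg Gx Gy _) (dirichletX_nonneg Gy Gx _)

theorem innerTM_comm (f g : GridFun) : innerTM Gx Gy f g = innerTM Gx Gy g f := by
  unfold innerTM
  exact Finset.sum_congr rfl fun _ _ => Finset.sum_congr rfl fun _ _ => by ring

theorem innerTM_self_nonneg (f : GridFun) : 0 ≤ innerTM Gx Gy f f :=
  Finset.sum_nonneg fun i hi => Finset.sum_nonneg fun j hj => by
    rw [mul_assoc]
    exact mul_nonneg (mul_pos (Gx.dual_pos hi) (Gy.cell_pos (Finset.mem_range.mp hj))).le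
      (mul_self_nonneg _)

theorem innerMT_self_nonneg (f : GridFun) : 0 ≤ innerMT Gx Gy f f := by
  rw [← innerTM_swap]
  exact innerTM_self_nonneg Gy Gx _

theorem velForm_comm (u v : GridFun × GridFun) : velForm Gx Gy u v = velForm Gx Gy v u := by
  rw [velForm_apply, velForm_apply, ← innerTM_swap, ← innerTM_swap, innerTM_comm,
    innerTM_comm Gy Gx]

theorem velForm_nonneg (u : GridFun × GridFun) : 0 ≤ velForm Gx Gy u u :=
  add_nonneg (innerTM_self_nonneg Gx Gy _) (innerMT_self_nonneg Gx Gy _)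

theorem vecNorm_eq (ux uy : GridFun) :
    vecNorm Gx Gy ux uy = √(velForm Gx Gy (ux, uy) (ux, uy)) := by
  rw [vecNorm, normTM, normMT, Real.sq_sqrt (innerTM_self_nonneg Gx Gy _),
    Real.sq_sqrt (innerMT_self_nonneg Gx Gy _)]
  rfl

theorem vecNorm_sq (ux uy : GridFun) :
    vecNorm Gx Gy ux uy ^ 2 = velForm Gx Gy (ux, uy) (ux, uy) := by
  rw [vecNorm_eq, Real.sq_sqrt (velForm_nonneg Gx Gy _)]

theorem innerTM_congr {f f' : GridFun} (g : GridFun)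
    (h : ∀ i ∈ Finset.Ico 1 Gx.num, ∀ j < Gy.num, f (2 * i) (2 * j + 1) = f' (2 * i) (2 * j + 1)) :
    innerTM Gx Gy f g = innerTM Gx Gy f' g :=
  Finset.sum_congr rfl fun i hi => Finset.sum_congr rfl fun j hj => by
    rw [h i hi j (Finset.mem_range.mp hj)]

/-- The discrete Laplace operator for the first velocity component. -/
noncomputable def lapX (u : GridFun) : GridFun := fun a b =>
  (dx Gx u (a / 2) b - dx Gx u (a / 2 - 1) b) / Gx.dual (a / 2)
    + (Dy Gy u a (b / 2 + 1) - Dy Gy u a (b / 2)) / Gy.cell (b / 2)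

theorem innerTM_lapX (u v : GridFun) (hx0 : ∀ j < Gy.num, v 0 (2 * j + 1) = 0)
    (hx1 : ∀ j < Gy.num, v (2 * Gx.num) (2 * j + 1) = 0)
    (hy0 : ∀ i ≤ Gx.num, v (2 * i) 0 = 0) (hy1 : ∀ i ≤ Gx.num, v (2 * i) (2 * Gy.num) = 0) :
    innerTM Gx Gy (lapX Gx Gy u) v = -dirichletX Gx Gy u v := by
  have half (l : ℕ) : (2 * l + 1) / 2 = l := by omega
  have half' (l : ℕ) : 2 * l / 2 = l := by omega
  have e : innerTM Gx Gy (lapX Gx Gy u) v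
      = ∑ j ∈ Finset.range Gy.num, ∑ i ∈ Finset.Ico 1 Gx.num,
          (dx Gx u i (2 * j + 1) - dx Gx u (i - 1) (2 * j + 1))
            * (Gy.cell j * v (2 * i) (2 * j + 1))
        + ∑ i ∈ Finset.Ico 1 Gx.num, ∑ j ∈ Finset.range Gy.num,
          (Dy Gy u (2 * i) (j + 1) - Dy Gy u (2 * i) j) * (Gx.dual i * v (2 * i) (2 * j + 1)) := by
    rw [Finset.sum_comm, ← Finset.sum_add_distrib]
    refine Finset.sum_congr rfl fun i hi => ?_
    rw [← Finset.sum_add_distrib]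
    refine Finset.sum_congr rfl fun j hj => ?_
    have h1 := (Gx.dual_pos hi).ne'
    have h2 := (Gy.cell_pos (Finset.mem_range.mp hj)).ne'
    simp only [lapX, half, half']
    field_simp
  rw [e, dirichletX, neg_add]
  congr 1
  · rw [Finset.sum_comm (s := Finset.range Gx.num), ← Finset.sum_neg_distrib]
    refine Finset.sum_congr rfl fun j hj => ?_
    have hj := Finset.mem_range.mp hj
    rw [sum_Ico_sub_mul_eq Gx.num_pos (fun i => dx Gx u i (2 * j + 1))
      (fun i => Gy.cell j * v (2 * i) (2 * j + 1)) (by simp [hx0 j hj]) (by simp [hx1 j hj])]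
    congr 1
    refine Finset.sum_congr rfl fun i hi => ?_
    have h1 := (Gx.cell_pos (Finset.mem_range.mp hi)).ne'
    rw [show dx Gx v i (2 * j + 1)
      = (v (2 * i + 2) (2 * j + 1) - v (2 * i) (2 * j + 1)) / Gx.cell i from rfl,
      show 2 * (i + 1) = 2 * i + 2 by ring]
    field_simp
  · rw [← Finset.sum_neg_distrib]
    refine Finset.sum_congr rfl fun i hi => ?_
    have hi' := (Finset.mem_Ico.mp hi).2.le
    rw [sum_range_sub_mul_eq Gy.num_pos (fun j => Dy Gy u (2 * i) j)
      (fun b => Gx.dual i * v (2 * i) b) (by simp [hy0 i hi']) (by simp [hy1 i hi'])]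
    congr 1
    refine Finset.sum_congr rfl fun j hj => ?_
    have hj' : j ≤ Gy.num := by simp at hj; omega
    have h1 : Gy.dual j ≠ 0 := by
      have hlast := Gy.cell_pos (i := j - 1)
      have hfirst := Gy.cell_pos (i := j)
      have := Gy.num_pos
      unfold Grid1D.dual
      split_ifs with h1 h2 h2
      · linarith [hlast (by omega), hfirst h1]
      · linarith [hfirst h1]
      · linarith [hlast (by omega)]
      · omega
    rw [show Dy Gy v (2 * i) j = (v (2 * i) (min (2 * j + 1) (2 * Gy.num)) - v (2 * i) (2 * j - 1))
      / Gy.dual j from rfl]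
    field_simp

/-- The discrete velocity `v` vanishes on the boundary and is divergence-free. -/
structure Admissible (v : GridFun × GridFun) : Prop where
  x_left : ∀ j < Gy.num, v.1 0 (2 * j + 1) = 0
  x_right : ∀ j < Gy.num, v.1 (2 * Gx.num) (2 * j + 1) = 0
  x_bottom : ∀ i ≤ Gx.num, v.1 (2 * i) 0 = 0
  x_top : ∀ i ≤ Gx.num, v.1 (2 * i) (2 * Gy.num) = 0
  y_left : ∀ j ≤ Gy.num, v.2 0 (2 * j) = 0
  y_right : ∀ j ≤ Gy.num, v.2 (2 * Gx.num) (2 * j) = 0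
  y_bottom : ∀ i < Gx.num, v.2 (2 * i + 1) 0 = 0
  y_top : ∀ i < Gx.num, v.2 (2 * i + 1) (2 * Gy.num) = 0
  div_free : ∀ i < Gx.num, ∀ j < Gy.num,
    dx Gx v.1 i (2 * j + 1) + dy Gy v.2 (2 * i + 1) j = 0

variable {Gx Gy}

theorem Admissible.sub {u v : GridFun × GridFun} (hu : Admissible Gx Gy u)
    (hv : Admissible Gx Gy v) : Admissible Gx Gy (u - v) where
  x_left j hj := by simp [hu.x_left j hj, hv.x_left j hj]
  x_right j hj := by simp [hu.x_right j hj, hv.x_right j hj]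
  x_bottom i hi := by simp [hu.x_bottom i hi, hv.x_bottom i hi]
  x_top i hi := by simp [hu.x_top i hi, hv.x_top i hi]
  y_left j hj := by simp [hu.y_left j hj, hv.y_left j hj]
  y_right j hj := by simp [hu.y_right j hj, hv.y_right j hj]
  y_bottom i hi := by simp [hu.y_bottom i hi, hv.y_bottom i hi]
  y_top i hi := by simp [hu.y_top i hi, hv.y_top i hi]
  div_free i hi j hj := by
    have h1 := hu.div_free i hi j hj
    have h2 := hv.div_free i hi j hj
    have e1 : dx Gx (u - v).1 i (2 * j + 1)
        = dx Gx u.1 i (2 * j + 1) - dx Gx v.1 i (2 * j + 1) := by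
      simp only [dx, Prod.fst_sub, Pi.sub_apply]; ring
    have e2 : dy Gy (u - v).2 (2 * i + 1) j
        = dy Gy u.2 (2 * i + 1) j - dy Gy v.2 (2 * i + 1) j := by
      simp only [dy, Prod.snd_sub, Pi.sub_apply]; ring
    rw [e1, e2]
    linarith

theorem Admissible.velForm_grad {v : GridFun × GridFun} (hv : Admissible Gx Gy v) (q : GridFun) :
    velForm Gx Gy (gradX Gx q, gradY Gy q) v = 0 :=
  inner_grad_eq_zero Gx Gy q v.1 v.2 hv.x_left hv.x_right hv.y_bottom hv.y_top hv.div_free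

section Solution

variable {μ Δt : ℝ} {N : ℕ} {gx gy : ℝ → ℝ → ℝ → ℝ} {Wx Wy Z : ℕ → GridFun}

theorem IsSolution.swap (h : IsSolution Gx Gy μ Δt N gx gy Wx Wy Z) :
    IsSolution Gy Gx μ Δt N (fun x y t => gy y x t) (fun x y t => gx y x t)
      (fun n => (Wy n).swap) (fun n => (Wx n).swap) (fun n => (Z n).swap) where
  bdry_x_left := h.bdry_y_bottom
  bdry_x_right := h.bdry_y_top
  bdry_x_bottom := h.bdry_y_left
  bdry_x_top := h.bdry_y_right
  bdry_y_left := h.bdry_x_bottom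
  bdry_y_right := h.bdry_x_top
  bdry_y_bottom := h.bdry_x_left
  bdry_y_top := h.bdry_x_right
  init_x i hi j hj := h.init_y j hj i hi
  init_y i hi j hj := h.init_x j hj i hi
  momentum_x n hn i hi j hj := by
    refine Eq.trans ?_ (h.momentum_y n hn j hj i hi)
    change _ - μ * ((dy Gy (Wy n) (2 * j + 1) i - dy Gy (Wy n) (2 * j + 1) (i - 1)) / Gy.dual i)
      - μ * ((Dx Gx (Wy n) (j + 1) (2 * i) - Dx Gx (Wy n) j (2 * i)) / Gx.cell j) + _ = _
    rw [sub_right_comm]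
    rfl
  momentum_y n hn i hi j hj := by
    refine Eq.trans ?_ (h.momentum_x n hn j hj i hi)
    change _ - μ * ((Dy Gy (Wx n) (2 * j) (i + 1) - Dy Gy (Wx n) (2 * j) i) / Gy.cell i)
      - μ * ((dx Gx (Wx n) j (2 * i + 1) - dx Gx (Wx n) (j - 1) (2 * i + 1)) / Gx.dual j) + _ = _
    rw [sub_right_comm]
    rfl
  div_free n hn i hi j hj := (add_comm _ _).trans (h.div_free n hn j hj i hi)
  mean_zero n hn := (innerM_swap Gx Gy (Z n) (fun _ _ => 1)).trans (h.mean_zero n hn)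

theorem IsSolution.momentum_x' (h : IsSolution Gx Gy μ Δt N gx gy Wx Wy Z) {n : ℕ}
    (hn : n ∈ Finset.Icc 1 N) {i : ℕ} (hi : i ∈ Finset.Ico 1 Gx.num) {j : ℕ} (hj : j < Gy.num) :
    gradX Gx (Z n) (2 * i) (2 * j + 1)
      = avgX Gx Gy gx (n * Δt) (2 * i) (2 * j + 1) - dt Δt Wx n (2 * i) (2 * j + 1)
        + μ * lapX Gx Gy (Wx n) (2 * i) (2 * j + 1) := by
  have hm := h.momentum_x n hn i hi j (Finset.mem_range.mpr hj)
  have half (l : ℕ) : (2 * l + 1) / 2 = l := by omega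
  have half' (l : ℕ) : 2 * l / 2 = l := by omega
  simp only [gradX, lapX, half, half']
  rw [mul_add]
  linarith

theorem IsSolution.weak_x (h : IsSolution Gx Gy μ Δt N gx gy Wx Wy Z) {n : ℕ}
    (hn : n ∈ Finset.Icc 1 N) (v : GridFun) (hx0 : ∀ j < Gy.num, v 0 (2 * j + 1) = 0)
    (hx1 : ∀ j < Gy.num, v (2 * Gx.num) (2 * j + 1) = 0)
    (hy0 : ∀ i ≤ Gx.num, v (2 * i) 0 = 0) (hy1 : ∀ i ≤ Gx.num, v (2 * i) (2 * Gy.num) = 0) :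
    innerTM Gx Gy (gradX Gx (Z n)) v = innerTM Gx Gy (avgX Gx Gy gx (n * Δt)) v
      - innerTM Gx Gy (dt Δt Wx n) v - μ * dirichletX Gx Gy (Wx n) v := by
  have h1 := innerTM_lapX Gx Gy (Wx n) v hx0 hx1 hy0 hy1
  rw [innerTM_congr Gx Gy v (f' := fun a b => avgX Gx Gy gx (n * Δt) a b - dt Δt Wx n a b
    + μ * lapX Gx Gy (Wx n) a b) fun i hi j hj => h.momentum_x' hn hi hj]
  have e : -(μ * dirichletX Gx Gy (Wx n) v) = μ * innerTM Gx Gy (lapX Gx Gy (Wx n)) v := by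
    rw [h1]; ring
  rw [sub_eq_add_neg _ (μ * _), e]
  simp only [innerTM, Finset.mul_sum, ← Finset.sum_add_distrib, ← Finset.sum_sub_distrib]
  exact Finset.sum_congr rfl fun _ _ => Finset.sum_congr rfl fun _ _ => by ring

theorem IsSolution.weak (h : IsSolution Gx Gy μ Δt N gx gy Wx Wy Z) {n : ℕ}
    (hn : n ∈ Finset.Icc 1 N) {v : GridFun × GridFun} (hv : Admissible Gx Gy v) :
    velForm Gx Gy (Δt⁻¹ • ((Wx n, Wy n) - (Wx (n - 1), Wy (n - 1)))) v
      + μ * gradForm Gx Gy (Wx n, Wy n) v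
      = velForm Gx Gy (avgX Gx Gy gx (n * Δt), avgY Gx Gy gy (n * Δt)) v := by
  have h1 := h.weak_x hn v.1 hv.x_left hv.x_right hv.x_bottom hv.x_top
  have h2 := h.swap.weak_x hn (GridFun.swap v.2) hv.y_bottom hv.y_top hv.y_left hv.y_right
  rw [gradX_swap, innerTM_swap,
    show avgX Gy Gx (fun x y t => gy y x t) (n * Δt) = (avgY Gx Gy gy (n * Δt)).swap from rfl,
    innerTM_swap, show dt Δt (fun n => (Wy n).swap) n = (dt Δt Wy n).swap from rfl,
    innerTM_swap] at h2
  have h3 := hv.velForm_grad (Z n)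
  have e : Δt⁻¹ • ((Wx n, Wy n) - (Wx (n - 1), Wy (n - 1))) = (dt Δt Wx n, dt Δt Wy n) := by
    ext a b <;> simp [dt, div_eq_inv_mul]
  rw [e, velForm_apply, velForm_apply, gradForm_apply]
  rw [velForm_apply] at h3
  simp only at h3 ⊢
  linarith

theorem IsSolution.init_x_eq_zero (h : IsSolution Gx Gy μ Δt N gx gy Wx Wy Z) {i : ℕ}
    (hi : i ≤ Gx.num) {j : ℕ} (hj : j < Gy.num) : Wx 0 (2 * i) (2 * j + 1) = 0 := by
  rcases Nat.eq_zero_or_pos i with rfl | h0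
  · exact h.bdry_x_left 0 (Nat.zero_le _) j hj
  rcases hi.eq_or_lt with rfl | h1
  · exact h.bdry_x_right 0 (Nat.zero_le _) j hj
  exact h.init_x i (Finset.mem_Ico.mpr ⟨h0, h1⟩) j (Finset.mem_range.mpr hj)

theorem IsSolution.admissible (h : IsSolution Gx Gy μ Δt N gx gy Wx Wy Z) {n : ℕ} (hn : n ≤ N) :
    Admissible Gx Gy (Wx n, Wy n) where
  x_left := h.bdry_x_left n hn
  x_right := h.bdry_x_right n hn
  x_bottom := h.bdry_x_bottom n hn
  x_top := h.bdry_x_top n hn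
  y_left := h.bdry_y_left n hn
  y_right := h.bdry_y_right n hn
  y_bottom := h.bdry_y_bottom n hn
  y_top := h.bdry_y_top n hn
  div_free i hi j hj := by
    rcases Nat.eq_zero_or_pos n with rfl | h0
    · have h1 := h.init_x_eq_zero (i := i) (by omega) hj
      have h2 := h.init_x_eq_zero (i := i + 1) (by omega) hj
      have h3 := h.swap.init_x_eq_zero (i := j) (by omega) hi
      have h4 := h.swap.init_x_eq_zero (i := j + 1) (by omega) hi
      simp only [GridFun.swap, mul_add, mul_one] at h1 h2 h3 h4
      simp [dx, dy, h1, h2, h3, h4]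
    · exact h.div_free n (Finset.mem_Icc.mpr ⟨h0, hn⟩) i (Finset.mem_range.mpr hi) j
        (Finset.mem_range.mpr hj)

theorem IsSolution.dirichletX_init (h : IsSolution Gx Gy μ Δt N gx gy Wx Wy Z) (v : GridFun) :
    dirichletX Gx Gy (Wx 0) v = 0 := by
  have h1 : ∀ i ∈ Finset.range Gx.num, ∀ j ∈ Finset.range Gy.num,
      dx Gx (Wx 0) i (2 * j + 1) = 0 := by
    intro i hi j hj
    have hi := Finset.mem_range.mp hi
    have hj := Finset.mem_range.mp hj
    have h1 := h.init_x_eq_zero (i := i) (by omega) hj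
    have h2 := h.init_x_eq_zero (i := i + 1) (by omega) hj
    simp only [mul_add, mul_one] at h2
    simp [dx, h1, h2]
  have h2 : ∀ i ∈ Finset.Ico 1 Gx.num, ∀ j ∈ Finset.range (Gy.num + 1),
      Dy Gy (Wx 0) (2 * i) j = 0 := by
    intro i hi j hj
    have hi := (Finset.mem_Ico.mp hi).2.le
    have hj := Finset.mem_range.mp hj
    have h1 : Wx 0 (2 * i) (min (2 * j + 1) (2 * Gy.num)) = 0 := by
      rcases Nat.lt_or_ge j Gy.num with h1 | h1
      · rw [min_eq_left (by omega)]
        exact h.init_x_eq_zero hi h1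
      · rw [min_eq_right (by omega)]
        exact h.bdry_x_top 0 (Nat.zero_le _) i hi
    have h2 : Wx 0 (2 * i) (2 * j - 1) = 0 := by
      rcases Nat.eq_zero_or_pos j with rfl | h2
      · exact h.bdry_x_bottom 0 (Nat.zero_le _) i hi
      · rw [show 2 * j - 1 = 2 * (j - 1) + 1 by omega]
        exact h.init_x_eq_zero hi (by omega)
    simp [Dy, h1, h2]
  rw [dirichletX, Finset.sum_eq_zero fun i hi => Finset.sum_eq_zero fun j hj => by
    rw [h1 i hi j hj]; ring, Finset.sum_eq_zero fun i hi => Finset.sum_eq_zero fun j hj => by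
    rw [h2 i hi j hj]; ring, add_zero]

theorem IsSolution.gradForm_init (h : IsSolution Gx Gy μ Δt N gx gy Wx Wy Z)
    (v : GridFun × GridFun) : gradForm Gx Gy (Wx 0, Wy 0) v = 0 := by
  rw [gradForm_apply, h.dirichletX_init, h.swap.dirichletX_init, add_zero]

theorem IsSolution.innerTM_init (h : IsSolution Gx Gy μ Δt N gx gy Wx Wy Z) (v : GridFun) :
    innerTM Gx Gy (Wx 0) v = 0 :=
  Finset.sum_eq_zero fun i hi => Finset.sum_eq_zero fun j hj => by rw [h.init_x i hi j hj]; ring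

theorem IsSolution.velForm_init (h : IsSolution Gx Gy μ Δt N gx gy Wx Wy Z)
    (v : GridFun × GridFun) : velForm Gx Gy (Wx 0, Wy 0) v = 0 := by
  rw [velForm_apply, ← innerTM_swap, h.innerTM_init, h.swap.innerTM_init, add_zero]

end Solution

end Operators

/-! ### Pressure estimate -/

theorem sum_range_succ_eq_sum_Ico {N : ℕ} (hN : 0 < N) (t : ℕ → ℝ) (h0 : t 0 = 0) (h1 : t N = 0) :
    ∑ j ∈ Finset.range (N + 1), t j = ∑ j ∈ Finset.Ico 1 N, t j := by
  rw [Finset.sum_range_succ, h1, add_zero, Finset.range_eq_Ico, Finset.sum_eq_sum_Ico_succ_bot hN,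
    h0, zero_add]

section Operators

variable {Lx Ly : ℝ} {Gx : Grid1D Lx} {Gy : Grid1D Ly} {μ Δt : ℝ} {N : ℕ}
  {gx gy : ℝ → ℝ → ℝ → ℝ} {Wx Wy Z : ℕ → GridFun}

/-- The vorticity of a discrete velocity, at the grid points, times the viscosity. -/
noncomputable def vorticity (Gx : Grid1D Lx) (Gy : Grid1D Ly) (μ : ℝ) (wx wy : GridFun) : GridFun :=
  fun a b => μ * (Dy Gy wx a (b / 2) - Dx Gx wy (a / 2) b)

theorem vorticity_swap (wx wy : GridFun) :
    vorticity Gy Gx μ wy.swap wx.swap = fun a b => -vorticity Gx Gy μ wx wy b a := by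
  funext a b
  simp only [vorticity]
  change μ * (Dx Gx wy (b / 2) a - Dy Gy wx b (a / 2)) = _
  ring

/-- For divergence-free velocities, the Laplace operator is the curl of the vorticity. -/
theorem lapX_eq_rotX {wx wy : GridFun} (hdiv : ∀ i < Gx.num, ∀ j < Gy.num,
      dx Gx wx i (2 * j + 1) + dy Gy wy (2 * i + 1) j = 0)
    {i : ℕ} (hi : i ∈ Finset.Ico 1 Gx.num) {j : ℕ} (hj : j < Gy.num) :
    μ * lapX Gx Gy wx (2 * i) (2 * j + 1)
      = rotX Gy (vorticity Gx Gy μ wx wy) (2 * i) (2 * j + 1) := by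
  have half (l : ℕ) : (2 * l + 1) / 2 = l := by omega
  have half' (l : ℕ) : 2 * l / 2 = l := by omega
  obtain ⟨h1, h2⟩ := Finset.mem_Ico.mp hi
  have d1 := hdiv i h2 j hj
  have d2 := hdiv (i - 1) (by omega) j hj
  have n1 := (Gx.dual_pos hi).ne'
  have n2 := (Gy.cell_pos hj).ne'
  simp only [lapX, rotX, vorticity, half, half', dy, show (2 * j + 2) / 2 = j + 1 by omega]
  rw [eq_neg_of_add_eq_zero_left d1, eq_neg_of_add_eq_zero_left d2]
  rw [Dx, Dx, min_eq_left (by omega : 2 * i + 1 ≤ 2 * Gx.num),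
    show 2 * (i - 1) + 1 = 2 * i - 1 by omega, dy, dy]
  field_simp
  ring

theorem nodeNormX_vorticity_le {wx wy : GridFun} (h : Admissible Gx Gy (wx, wy)) :
    nodeNormX Gx Gy (vorticity Gx Gy μ wx wy) ≤ 2 * μ ^ 2 * gradForm Gx Gy (wx, wy) (wx, wy) := by
  have h1 := nodeNormX_le_dirichletX Gx Gy wx
  have h2 := nodeNormX_le_dirichletX Gy Gx wy.swap
  -- the second velocity component vanishes at the bottom and at the top
  have h3 : nodeNormX Gx Gy (fun a b => Dx Gx wy (a / 2) b)
      ≤ nodeNormX Gy Gx (fun a b => Dy Gx wy.swap a (b / 2)) := by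
    have e (i : ℕ) (hi : i ∈ Finset.Ico 1 Gx.num) : ∑ j ∈ Finset.range (Gy.num + 1),
        Gx.dual i * Gy.dual j * (Dx Gx wy (2 * i / 2) (2 * j)) ^ 2
        = ∑ j ∈ Finset.Ico 1 Gy.num,
          Gy.dual j * Gx.dual i * (Dy Gx wy.swap (2 * j) (2 * i / 2)) ^ 2 := by
      obtain ⟨hi1, hi2⟩ := Finset.mem_Ico.mp hi
      rw [sum_range_succ_eq_sum_Ico Gy.num_pos]
      · exact Finset.sum_congr rfl fun j _ => by rw [mul_comm (Gx.dual i)]; rfl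
      all_goals
        rw [Nat.mul_div_cancel_left _ two_pos, Dx, min_eq_left (by omega),
          show 2 * i - 1 = 2 * (i - 1) + 1 by omega]
      · have a1 := h.y_bottom i hi2
        have a2 := h.y_bottom (i - 1) (by omega)
        simp only at a1 a2
        simp [a1, a2]
      · have a1 := h.y_top i hi2
        have a2 := h.y_top (i - 1) (by omega)
        simp only at a1 a2
        simp [a1, a2]
    unfold nodeNormX
    rw [Finset.sum_congr rfl e, Finset.sum_comm (s := Finset.Ico 1 Gy.num)]
    refine Finset.sum_le_sum_of_subset_of_nonneg
      (fun i hi => by simp only [Finset.mem_Ico, Finset.mem_range] at *; omega) fun i hi _ => ?_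
    exact Finset.sum_nonneg fun j hj => mul_nonneg (mul_nonneg (Gy.dual_pos hj).le
      (Gx.dual_nonneg i (by simp at hi; omega))) (sq_nonneg _)
  have h4 : nodeNormX Gx Gy (vorticity Gx Gy μ wx wy)
      ≤ 2 * μ ^ 2 * (nodeNormX Gx Gy (fun a b => Dy Gy wx a (b / 2))
        + nodeNormX Gx Gy (fun a b => Dx Gx wy (a / 2) b)) := by
    simp only [nodeNormX, Finset.mul_sum, ← Finset.sum_add_distrib]
    refine Finset.sum_le_sum fun i hi => Finset.sum_le_sum fun j hj => ?_
    have hd := mul_nonneg (Gx.dual_pos hi).le (Gy.dual_nonneg j (by simp at hj; omega))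
    rw [← mul_add, mul_left_comm]
    refine mul_le_mul_of_nonneg_left ?_ hd
    simp only [vorticity]
    generalize Dy Gy wx (2 * i) (2 * j / 2) = u
    generalize Dx Gx wy (2 * i / 2) (2 * j) = v
    nlinarith [sq_nonneg (μ * (u + v))]
  refine h4.trans (mul_le_mul_of_nonneg_left ?_ (by positivity))
  rw [gradForm_apply]
  exact add_le_add h1 (h3.trans h2)

theorem Admissible.swap {wx wy : GridFun} (h : Admissible Gx Gy (wx, wy)) :
    Admissible Gy Gx (wy.swap, wx.swap) where
  x_left := h.y_bottom
  x_right := h.y_top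
  x_bottom := h.y_left
  x_top := h.y_right
  y_left := h.x_bottom
  y_right := h.x_top
  y_bottom := h.x_left
  y_top := h.x_right
  div_free i hi j hj := (add_comm _ _).trans (h.div_free j hj i hi)

theorem nodeNormX_swap_vorticity_le {wx wy : GridFun} (h : Admissible Gx Gy (wx, wy)) :
    nodeNormX Gy Gx (vorticity Gx Gy μ wx wy).swap
      ≤ 2 * μ ^ 2 * gradForm Gx Gy (wx, wy) (wx, wy) := by
  have key := nodeNormX_vorticity_le (μ := μ) h.swap
  have e1 : nodeNormX Gy Gx (vorticity Gy Gx μ wy.swap wx.swap)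
      = nodeNormX Gy Gx (vorticity Gx Gy μ wx wy).swap := by
    rw [vorticity_swap]
    simp only [nodeNormX, neg_sq, GridFun.swap]
  have e2 : gradForm Gy Gx (wy.swap, wx.swap) (wy.swap, wx.swap)
      = gradForm Gx Gy (wx, wy) (wx, wy) := by
    rw [gradForm_apply, gradForm_apply, add_comm]
    rfl
  rwa [e1, e2] at key

/-- The gradient of the discrete pressure is the force minus the acceleration, plus the curl of
the vorticity. -/
theorem IsSolution.weighted_le (h : IsSolution Gx Gy μ Δt N gx gy Wx Wy Z) {n : ℕ}
    (hn : n ∈ Finset.Icc 1 N) :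
    weightedX Gx Gy (Z n) + weightedY Gx Gy (Z n)
      ≤ 32 * (velForm Gx Gy (avgX Gx Gy gx (n * Δt), avgY Gx Gy gy (n * Δt))
            (avgX Gx Gy gx (n * Δt), avgY Gx Gy gy (n * Δt))
          + velForm Gx Gy (Δt⁻¹ • ((Wx n, Wy n) - (Wx (n - 1), Wy (n - 1))))
            (Δt⁻¹ • ((Wx n, Wy n) - (Wx (n - 1), Wy (n - 1)))))
        + 480 * (1 / Lx ^ 2 + 1 / Ly ^ 2)
          * (μ ^ 2 * gradForm Gx Gy (Wx n, Wy n) (Wx n, Wy n)) := by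
  have hadm := h.admissible (Finset.mem_Icc.mp hn).2
  have key := RMAC.weighted_le Gx Gy (Z n)
    (fun a b => avgX Gx Gy gx (n * Δt) a b - dt Δt Wx n a b)
    (fun a b => avgY Gx Gy gy (n * Δt) a b - dt Δt Wy n a b)
    (vorticity Gx Gy μ (Wx n) (Wy n))
    (fun i hi j hj => by rw [h.momentum_x' hn hi hj, lapX_eq_rotX hadm.div_free hi hj])
    (fun i hi j hj => by
      have h1 := h.swap.momentum_x' hn hj hi
      rw [lapX_eq_rotX hadm.swap.div_free hj hi, vorticity_swap] at h1
      refine h1.trans (congrArg₂ (· + ·) rfl ?_)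
      simp only [rotX, rotY, dy, dx]
      ring)
  have e : Δt⁻¹ • ((Wx n, Wy n) - (Wx (n - 1), Wy (n - 1))) = (dt Δt Wx n, dt Δt Wy n) := by
    ext a b <;> simp [dt, div_eq_inv_mul]
  rw [e]
  have h1 := mul_le_mul_of_nonneg_left (nodeNormX_vorticity_le (μ := μ) hadm)
    (by positivity : 0 ≤ 240 / Ly ^ 2)
  have h2 := mul_le_mul_of_nonneg_left (nodeNormX_swap_vorticity_le (μ := μ) hadm)
    (by positivity : 0 ≤ 240 / Lx ^ 2)
  -- `‖f - d‖² + ‖f + d‖² = 2 ‖f‖² + 2 ‖d‖²`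
  set f := (avgX Gx Gy gx (n * Δt), avgY Gx Gy gy (n * Δt)) with hf
  set d := (dt Δt Wx n, dt Δt Wy n) with hd
  have h3 : velForm Gx Gy (f - d) (f - d) ≤ 2 * (velForm Gx Gy f f + velForm Gx Gy d d) := by
    have h4 := velForm_nonneg Gx Gy (f + d)
    simp only [map_sub, map_add, LinearMap.sub_apply, LinearMap.add_apply] at h4 ⊢
    linarith
  change _ ≤ 16 * velForm Gx Gy (f - d) (f - d) + _ at key
  have e2 : 480 * (1 / Lx ^ 2 + 1 / Ly ^ 2)
      * (μ ^ 2 * gradForm Gx Gy (Wx n, Wy n) (Wx n, Wy n))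
      = 240 / Ly ^ 2 * (2 * μ ^ 2 * gradForm Gx Gy (Wx n, Wy n) (Wx n, Wy n))
        + 240 / Lx ^ 2 * (2 * μ ^ 2 * gradForm Gx Gy (Wx n, Wy n) (Wx n, Wy n)) := by ring
  rw [e2]
  linarith

/-! ### Averages of gradients -/

/-- The averages of `g - ∇p` are the averages of `g` minus the discrete gradient of `p`. -/
theorem avgX_betaX {p : ℝ → ℝ → ℝ → ℝ} {t : ℝ}
    (hp : ContDiffOn ℝ 1 (fun z : ℝ × ℝ => p z.1 z.2 t) (Set.Ioo 0 Lx ×ˢ Set.Ioo 0 Ly))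
    {i : ℕ} (hi : i ∈ Finset.Ico 1 Gx.num) {j : ℕ} (hj : j < Gy.num)
    (hg : IntervalIntegrable (fun x => gx x (Gy.pt (2 * j + 1)) t) MeasureTheory.volume
      (Gx.pt (2 * i - 1)) (Gx.pt (2 * i + 1))) :
    avgX Gx Gy (betaX gx p) t (2 * i) (2 * j + 1)
      = avgX Gx Gy gx t (2 * i) (2 * j + 1)
        - gradX Gx (fun a b => p (Gx.pt a) (Gy.pt b) t) (2 * i) (2 * j + 1) := by
  obtain ⟨h1, h2⟩ := Finset.mem_Ico.mp hi
  have hy : Gy.pt (2 * j + 1) ∈ Set.Ioo 0 Ly := by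
    have a1 := Gy.pt_lt (a := 0) (b := 2 * j + 1) (by omega) (by omega)
    have a2 := Gy.pt_lt (a := 2 * j + 1) (b := 2 * Gy.num) (by omega) le_rfl
    rw [Gy.pt_zero] at a1
    rw [Gy.pt_last] at a2
    exact ⟨a1, a2⟩
  have hle : Gx.pt (2 * i - 1) ≤ Gx.pt (2 * i + 1) := Gx.pt_le (by omega) (by omega)
  have hsub : Set.uIcc (Gx.pt (2 * i - 1)) (Gx.pt (2 * i + 1)) ⊆ Set.Ioo 0 Lx := by
    rw [Set.uIcc_of_le hle]
    intro x hx
    have a1 := Gx.pt_lt (a := 0) (b := 2 * i - 1) (by omega) (by omega)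
    have a2 := Gx.pt_lt (a := 2 * i + 1) (b := 2 * Gx.num) (by omega) le_rfl
    rw [Gx.pt_zero] at a1
    rw [Gx.pt_last] at a2
    exact ⟨a1.trans_le hx.1, hx.2.trans_lt a2⟩
  have hφ : ContDiffOn ℝ 1 (fun s => p s (Gy.pt (2 * j + 1)) t) (Set.Ioo 0 Lx) :=
    hp.comp (f := fun s : ℝ => (s, Gy.pt (2 * j + 1))) (by fun_prop) fun s hs => ⟨hs, hy⟩
  have hd : IntervalIntegrable (deriv fun s => p s (Gy.pt (2 * j + 1)) t) MeasureTheory.volume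
      (Gx.pt (2 * i - 1)) (Gx.pt (2 * i + 1)) :=
    ((hφ.continuousOn_deriv_of_isOpen isOpen_Ioo le_rfl).mono hsub).intervalIntegrable
  have ftc := intervalIntegral.integral_deriv_eq_sub (fun x hx =>
    (hφ.differentiableOn one_ne_zero).differentiableAt (isOpen_Ioo.mem_nhds (hsub hx))) hd
  rw [gradX_apply _ _ hi]
  simp only [avgX, betaX]
  rw [intervalIntegral.integral_sub hg hd, ftc, Nat.mul_div_cancel_left _ two_pos]
  ring

theorem velForm_avg_beta {p : ℝ → ℝ → ℝ → ℝ} {t : ℝ}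
    (hp : ContDiffOn ℝ 1 (fun z : ℝ × ℝ => p z.1 z.2 t) (Set.Ioo 0 Lx ×ˢ Set.Ioo 0 Ly))
    (hg : SegmentIntegrable Gx Gy gx gy t) {v : GridFun × GridFun} (hv : Admissible Gx Gy v) :
    velForm Gx Gy (avgX Gx Gy (betaX gx p) t, avgY Gx Gy (betaY gy p) t) v
      = velForm Gx Gy (avgX Gx Gy gx t, avgY Gx Gy gy t) v := by
  set P : GridFun := fun a b => p (Gx.pt a) (Gy.pt b) t with hP
  have hp' : ContDiffOn ℝ 1 (fun z : ℝ × ℝ => p z.2 z.1 t) (Set.Ioo 0 Ly ×ˢ Set.Ioo 0 Lx) :=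
    hp.comp (f := fun z : ℝ × ℝ => (z.2, z.1)) (by fun_prop) fun z hz => ⟨hz.2, hz.1⟩
  have hx := innerTM_congr Gx Gy v.1 (f := avgX Gx Gy (betaX gx p) t)
    (f' := avgX Gx Gy gx t - gradX Gx P)
    fun i hi j hj => avgX_betaX hp hi hj (hg.1 i hi j (Finset.mem_range.mpr hj))
  have hy := innerTM_congr Gy Gx (GridFun.swap v.2)
    (f := avgX Gy Gx (betaX (fun x y t => gy y x t) (fun x y t => p y x t)) t)
    (f' := avgX Gy Gx (fun x y t => gy y x t) t - gradX Gy P.swap)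
    fun j hj i hi => avgX_betaX hp' hj hi (hg.2 i (Finset.mem_range.mpr hi) j hj)
  have h0 := hv.velForm_grad P
  have e : velForm Gx Gy ((avgX Gx Gy gx t, avgY Gx Gy gy t) - (gradX Gx P, gradY Gy P)) v
      = velForm Gx Gy (avgX Gx Gy gx t, avgY Gx Gy gy t) v := by
    rw [map_sub, LinearMap.sub_apply, h0, sub_zero]
  rw [← e, velForm_apply, velForm_apply, ← innerTM_swap, ← innerTM_swap]
  exact congrArg₂ (· + ·) hx hy

end Operators

/-! ### Stability -/

/-- The Cauchy–Schwarz inequality for a time integral over at most `T`. -/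
theorem sq_sum_mul_sqrt_le {S : Finset ℕ} {N : ℕ} {T τ : ℝ} (hτ : 0 ≤ τ) (hT : N * τ = T)
    (hS : S ⊆ Finset.Icc 1 N) (b : ℕ → ℝ) (hb : ∀ n, 0 ≤ b n) :
    (∑ n ∈ S, τ * √(b n)) ^ 2 ≤ T * ∑ n ∈ S, τ * b n := by
  have h1 : (∑ n ∈ S, τ * √(b n)) ^ 2 ≤ (∑ _n ∈ S, τ) * ∑ n ∈ S, τ * b n :=
    Finset.sum_sq_le_sum_mul_sum_of_sq_le_mul _ (fun _ _ => hτ)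
      (fun n _ => mul_nonneg hτ (hb n)) fun n _ => by
        rw [mul_pow, Real.sq_sqrt (hb n)]
        exact le_of_eq (by ring)
  refine h1.trans (mul_le_mul_of_nonneg_right ?_
    (Finset.sum_nonneg fun n _ => mul_nonneg hτ (hb n)))
  rw [Finset.sum_const, nsmul_eq_mul, ← hT]
  refine mul_le_mul_of_nonneg_right ?_ hτ
  have := Finset.card_le_card hS
  rw [Nat.card_Icc, add_tsub_cancel_right] at this
  exact_mod_cast this

end RMAC

open RMAC in
theorem mainTheorem3 (Lx Ly T C₀ : ℝ) (hLx : 0 < Lx) (hLy : 0 < Ly) (hT : 0 < T) (hC₀ : 0 < C₀) :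
    -- the constant and the bound on the time step do not depend on the viscosity, the mesh, the
    -- number of time steps, the source term, the pressure or the discrete solution
    ∃ C > 0, ∃ δ > 0,
      ∀ (μ : ℝ) (_hμ : 0 < μ)
        (Gx : RMAC.Grid1D Lx) (Gy : RMAC.Grid1D Ly) (_hG : RMAC.IsRegular Gx Gy C₀)
        (N : ℕ) (_hN : 0 < N) (Δt : ℝ) (_hΔt : Δt = T / N) (_hδ : Δt ≤ δ)
        (gx gy : ℝ → ℝ → ℝ → ℝ)
        (_hg : ∀ n ∈ Finset.Icc 1 N, RMAC.SegmentIntegrable Gx Gy gx gy (n * Δt))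
        (Wx Wy Z : ℕ → RMAC.GridFun) (_hW : RMAC.IsSolution Gx Gy μ Δt N gx gy Wx Wy Z)
        (fx fy : ℕ → RMAC.GridFun)
        (_hfx : fx = fun (n : ℕ) => RMAC.avgX Gx Gy gx (n * Δt))
        (_hfy : fy = fun (n : ℕ) => RMAC.avgY Gx Gy gy (n * Δt)),
        -- velocity bound, with `β = g - ∇p`
        (∀ p : ℝ → ℝ → ℝ → ℝ,
          (∀ t ∈ Set.Ioc 0 T, ContDiffOn ℝ 1 (fun z : ℝ × ℝ => p z.1 z.2 t)
            (Set.Ioo 0 Lx ×ˢ Set.Ioo 0 Ly)) →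
          ∀ m ∈ Finset.Icc 1 N,
            RMAC.vecNorm Gx Gy (Wx m) (Wy m) ^ 2
              ≤ C * ∑ n ∈ Finset.Icc 1 m, Δt *
                  RMAC.vecNorm Gx Gy (RMAC.avgX Gx Gy (RMAC.betaX gx p) (n * Δt))
                    (RMAC.avgY Gx Gy (RMAC.betaY gy p) (n * Δt)) ^ 2) ∧
        -- pressure bound
        (∀ m ∈ Finset.Icc 1 N,
          RMAC.normM Gx Gy (Z m) ^ 2
            ≤ C * (∑ n ∈ Finset.Icc 2 m, Δt *
                    RMAC.vecNorm Gx Gy (RMAC.dt Δt fx n) (RMAC.dt Δt fy n) ^ 2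
                + μ * ∑ n ∈ Finset.Icc 1 m, Δt * RMAC.vecNorm Gx Gy (fx n) (fy n) ^ 2
                + RMAC.vecNorm Gx Gy (fx 1) (fy 1) ^ 2
                + RMAC.vecNorm Gx Gy (fx m) (fy m) ^ 2)) := by
  obtain ⟨K, hK, hpoincare⟩ := exists_innerM_le_weighted hLx hLy hC₀
  -- the estimates hold for all time steps
  refine ⟨T + K * (96 + 64 * T + 480 * (1 / Lx ^ 2 + 1 / Ly ^ 2)), by positivity, 1, one_pos, ?_⟩
  intro μ hμ Gx Gy hG N hN Δt hΔt _ gx gy hg Wx Wy Z hW fx fy hfx hfy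
  have hN' : (0 : ℝ) < N := Nat.cast_pos.mpr hN
  have hτ : 0 < Δt := by rw [hΔt]; positivity
  have hNτ : N * Δt = T := by rw [hΔt]; field_simp
  have hA := gradForm_nonneg Gx Gy
  have hB := velForm_nonneg Gx Gy
  have hBs := velForm_comm Gx Gy
  constructor
  · intro p hp m hm
    obtain ⟨hm1, hmN⟩ := Finset.mem_Icc.mp hm
    have key := sqrt_le_sum_of_euler hA hB hBs (w := fun n => (Wx n, Wy n))
      (f := fun n => (avgX Gx Gy (betaX gx p) (n * Δt), avgY Gx Gy (betaY gy p) (n * Δt)))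
      hτ hμ (hW.velForm_init _) (N := N) (fun n hn => by
        obtain ⟨hn1, hnN⟩ := Finset.mem_Icc.mp hn
        have hn1' : (0 : ℝ) < n := Nat.cast_pos.mpr hn1
        have hadm := hW.admissible hnN
        have ht : n * Δt ∈ Set.Ioc 0 T := by
          refine ⟨by positivity, ?_⟩
          rw [← hNτ]
          exact mul_le_mul_of_nonneg_right (Nat.cast_le.mpr hnN) hτ.le
        rw [velForm_avg_beta (hp _ ht) (hg n hn) hadm]
        exact hW.weak hn hadm) m hmN
    have hcs := sq_sum_mul_sqrt_le hτ.le hNτ (Finset.Icc_subset_Icc_right hmN)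
      (fun n => velForm Gx Gy
        (avgX Gx Gy (betaX gx p) (n * Δt), avgY Gx Gy (betaY gy p) (n * Δt))
        (avgX Gx Gy (betaX gx p) (n * Δt), avgY Gx Gy (betaY gy p) (n * Δt))) fun n => hB _
    simp only [vecNorm_sq]
    rw [← Real.sq_sqrt (hB (Wx m, Wy m))]
    refine ((pow_le_pow_left₀ (Real.sqrt_nonneg _) key 2).trans hcs).trans ?_
    refine mul_le_mul_of_nonneg_right ?_ (Finset.sum_nonneg fun n _ => mul_nonneg hτ.le (hB _))
    exact le_add_of_nonneg_right (by positivity)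
  · intro m hm
    obtain ⟨hm1, hmN⟩ := Finset.mem_Icc.mp hm
    have hweak : ∀ n ∈ Finset.Icc 1 N, ∀ l ∈ Finset.Icc 1 N,
        velForm Gx Gy (Δt⁻¹ • ((Wx n, Wy n) - (Wx (n - 1), Wy (n - 1))))
            ((Wx l, Wy l) - (Wx (l - 1), Wy (l - 1)))
          + μ * gradForm Gx Gy (Wx n, Wy n) ((Wx l, Wy l) - (Wx (l - 1), Wy (l - 1)))
        = velForm Gx Gy (fx n, fy n) ((Wx l, Wy l) - (Wx (l - 1), Wy (l - 1))) := by
      intro n hn l hl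
      have hl' := (Finset.mem_Icc.mp hl).2
      rw [hfx, hfy]
      exact hW.weak hn ((hW.admissible hl').sub (hW.admissible (by omega)))
    have hdt := sqrt_diff_le_sum_of_euler hA hB hBs (w := fun n => (Wx n, Wy n))
      (f := fun n => (fx n, fy n)) hτ hμ hW.gradForm_init hweak m hm
    have hdiss := dissipation_le_sum_of_euler hB hBs hA (gradForm_comm Gx Gy)
      (w := fun n => (Wx n, Wy n)) (f := fun n => (fx n, fy n)) hτ hμ (hW.gradForm_init _)
      (fun n hn => hweak n hn n hn) m hmN
    have hcs := sq_sum_mul_sqrt_le hτ.le hNτ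
      ((Finset.Icc_subset_Icc_right hmN).trans (Finset.Icc_subset_Icc_left one_le_two))
      (fun n => velForm Gx Gy (Δt⁻¹ • ((fx n, fy n) - (fx (n - 1), fy (n - 1))))
        (Δt⁻¹ • ((fx n, fy n) - (fx (n - 1), fy (n - 1))))) (S := Finset.Icc 2 m) fun n => hB _
    have hZ := (hpoincare Gx Gy hG (Z m) (hW.mean_zero m hm)).trans
      (mul_le_mul_of_nonneg_left (hW.weighted_le hm) hK.le)
    have hZ0 : 0 ≤ innerM Gx Gy (Z m) (Z m) :=
      Finset.sum_nonneg fun i hi => Finset.sum_nonneg fun j hj => by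
        rw [mul_assoc]
        exact mul_nonneg (mul_pos (Gx.cell_pos (Finset.mem_range.mp hi))
          (Gy.cell_pos (Finset.mem_range.mp hj))).le (mul_self_nonneg _)
    have edt (n : ℕ) : (dt Δt fx n, dt Δt fy n)
        = Δt⁻¹ • ((fx n, fy n) - (fx (n - 1), fy (n - 1))) := by
      ext a b <;> simp [dt, div_eq_inv_mul]
    have em : (avgX Gx Gy gx (m * Δt), avgY Gx Gy gy (m * Δt)) = (fx m, fy m) := by
      rw [hfx, hfy]
    rw [em] at hZ
    rw [normM, Real.sq_sqrt hZ0]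
    simp only [vecNorm_sq, edt]
    have hf1 := hB (fx 1, fy 1)
    have hfm := hB (fx m, fy m)
    have hD0 := Finset.sum_nonneg (s := Finset.Icc 2 m) fun n _ => mul_nonneg hτ.le
      (hB (Δt⁻¹ • ((fx n, fy n) - (fx (n - 1), fy (n - 1)))))
    have hF0 := Finset.sum_nonneg (s := Finset.Icc 1 m) fun n _ => mul_nonneg hτ.le
      (hB (fx n, fy n))
    generalize Δt⁻¹ • ((Wx m, Wy m) - (Wx (m - 1), Wy (m - 1))) = w at *
    have hμF := mul_nonneg hμ.le hF0
    have hgrad := mul_le_mul_of_nonneg_left hdiss hμ.le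
    rw [← mul_assoc, ← sq] at hgrad
    generalize velForm Gx Gy (fx m, fy m) (fx m, fy m) = am at *
    generalize ∑ n ∈ Finset.Icc 2 m, Δt *
      velForm Gx Gy (Δt⁻¹ • ((fx n, fy n) - (fx (n - 1), fy (n - 1))))
        (Δt⁻¹ • ((fx n, fy n) - (fx (n - 1), fy (n - 1)))) = D at *
    generalize μ * ∑ n ∈ Finset.Icc 1 m, Δt * velForm Gx Gy (fx n, fy n) (fx n, fy n) = F at *
    generalize μ ^ 2 * gradForm Gx Gy (Wx m, Wy m) (Wx m, Wy m) = G at *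
    -- the bound of the acceleration, squared
    have hw : velForm Gx Gy w w ≤ 2 * velForm Gx Gy (fx 1, fy 1) (fx 1, fy 1) + 2 * (T * D) := by
      have h1 := pow_le_pow_left₀ (Real.sqrt_nonneg _) hdt 2
      have h2 := Real.sq_sqrt hf1
      rw [Real.sq_sqrt (hB w)] at h1
      refine (h1.trans (add_sq_le ..)).trans ?_
      rw [h2]
      linarith
    generalize velForm Gx Gy (fx 1, fy 1) (fx 1, fy 1) = a₁ at *
    have hS : 0 ≤ 1 / Lx ^ 2 + 1 / Ly ^ 2 := by positivity
    generalize 1 / Lx ^ 2 + 1 / Ly ^ 2 = S at *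
    have hTD := mul_nonneg hT.le hD0
    refine hZ.trans ?_
    have hR : 0 ≤ D + F + a₁ + am := by positivity
    have hmain : 32 * (am + velForm Gx Gy w w) + 480 * S * G
        ≤ (96 + 64 * T + 480 * S) * (D + F + a₁ + am) := by
      have h1 := mul_le_mul_of_nonneg_left hgrad hS
      have h2 := mul_nonneg hS (by positivity : 0 ≤ D + a₁ + am)
      have h3 := mul_nonneg hT.le (by positivity : 0 ≤ F + a₁ + am)
      linarith
    have h1 := mul_le_mul_of_nonneg_left hmain hK.le
    have h2 := mul_nonneg hT.le hR
    linarith
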